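/- Let $d\ge 1$ and let $\lambda$ be Lebesgue measure on $\mathbb R^d$ with the Euclidean metric. For sets $A_1,A_2,\dots\subset\mathbb R^d$ write $\limsup A_i=\bigcap_{n\ge1}\bigcup_{i\ge n}A_i$, and for $A\subset\mathbb R^d$ and $s>0$ let $$\mathcal H^s_\infty(A)=\inf\Big\{\sum_{i=1}^\infty(\operatorname{diam}D_i)^s : A\subset\bigcup_{i=1}^\infty D_i,\ D_i\text{ closed balls}\Big\}$$ be the $s$-dimensional Hausdorff content (balls of radius $0$ being allowed in the covers). Let $(B_i)_{i\ge1}$ be a sequence of (open or closed) balls of positive radius contained in $[0,1]^d$, whose diameters tend to $0$ as $i\to\infty$, and suppose that $\lambda(\limsup B_i)=1$. Let $s\in(0,d)$ and for every $i$ let $E_i\subset B_i$ be an open subset of $\mathbb R^d$ with $\mathcal H^s_\infty(E_i)\ge\lambda(B_i)$. Then $$\dim_{\mathcal H}\limsup E_i\ge s\qquad\text{and}\qquad \dim_{\mathcal P}\limsup E_i=d,$$ where $\dim_{\mathcal H}$ is the Hausdorff dimension and $\dim_{\mathcal P}$ is the packing dimension (the critical exponent of the packing measures). -/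

import Mathlib

open Filter Topology MeasureTheory
open scoped NNReal ENNReal

/-- The closed unit cube `[0,1]^d` in Euclidean space. -/
def unitCube (d : ℕ) : Set (EuclideanSpace ℝ (Fin d)) :=
  {x | ∀ j, x j ∈ Set.Icc (0 : ℝ) 1}

/-- The `s`-dimensional Hausdorff content of `A`: the infimum of `∑ (diam D_i)^s` over all
sequences of closed balls `D_i` that cover `A`. -/
noncomputable def hausdorffContent {d : ℕ} (s : ℝ) (A : Set (EuclideanSpace ℝ (Fin d))) : ℝ≥0∞ :=
  ⨅ (c : ℕ → EuclideanSpace ℝ (Fin d)) (r : ℕ → ℝ≥0)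
    (_ : A ⊆ ⋃ i, Metric.closedBall (c i) (r i)),
    ∑' i, Metric.ediam (Metric.closedBall (c i) (r i : ℝ)) ^ s

/-- A `δ`-packing of `A`: a family of pairwise disjoint closed balls with centres in `A` and
radii in `(0, δ]`, each ball being recorded as a pair (centre, radius). In Euclidean space such a
family is automatically countable. -/
structure IsPacking {d : ℕ} (δ : ℝ) (A : Set (EuclideanSpace ℝ (Fin d)))
    (P : Set (EuclideanSpace ℝ (Fin d) × ℝ)) : Prop where
  center_mem : ∀ p ∈ P, p.1 ∈ A
  radius_pos : ∀ p ∈ P, 0 < p.2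
  radius_le : ∀ p ∈ P, p.2 ≤ δ
  disjoint : P.PairwiseDisjoint fun p => Metric.closedBall p.1 p.2

/-- The `s`-dimensional packing premeasure of `A`: the limit as `δ → 0` (that is, the infimum over
`δ > 0`) of the supremum of `∑ (diam B)^s` over all `δ`-packings of `A`. -/
noncomputable def packingPremeasure {d : ℕ} (s : ℝ) (A : Set (EuclideanSpace ℝ (Fin d))) : ℝ≥0∞ :=
  ⨅ (δ : ℝ) (_ : 0 < δ), ⨆ (P : Set (EuclideanSpace ℝ (Fin d) × ℝ)) (_ : IsPacking δ A P),
    ∑' p : P, Metric.ediam (Metric.closedBall p.1.1 p.1.2) ^ s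

/-- The `s`-dimensional packing measure of `A`: the infimum of the sums of packing premeasures over
all countable covers of `A`. -/
noncomputable def packingMeasure {d : ℕ} (s : ℝ) (A : Set (EuclideanSpace ℝ (Fin d))) : ℝ≥0∞ :=
  ⨅ (S : ℕ → Set (EuclideanSpace ℝ (Fin d))) (_ : A ⊆ ⋃ n, S n), ∑' n, packingPremeasure s (S n)

/-- The packing dimension of `A`: the supremum of those `s ≥ 0` for which the `s`-dimensional
packing measure of `A` is infinite. It is `0` if there is no such `s`. -/
noncomputable def dimP {d : ℕ} (A : Set (EuclideanSpace ℝ (Fin d))) : ℝ≥0∞ :=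
  ⨆ (s : ℝ≥0) (_ : packingMeasure (s : ℝ) A = ∞), (s : ℝ≥0∞)

/-! Hausdorff dimension. Fix 0 < t < s and cover by dyadic cubes, a cube of side 2^(-m) costing
2^(-tm). Call a set saturated if covering its trace on any dyadic cube inside [0,1]^d costs at least
as much as that cube. The tail unions G_n = ⋃_{i ≥ n} E_i are saturated
(`dyadicWeight_le_netCost_of_iUnion_inter_subset`). Indeed, disjoint balls B_i fill a fixed
proportion of any open O ⊆ [0,1]^d, and small cubes covering E_i have s-cost at least a multiple of
λ(B_i). So if cubes of level at least m cover G_n ∩ O, then λ(O) is at most a constant times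
2^(-(s-t)m) times their t-cost (`exists_volume_le_mul_netCost`). Hence the cubes of a cheap cover of
G_n ∩ Q would have to exhaust the volume of Q, but proper subcubes of Q have too little volume for
their cost.

Saturated open sets intersect well: a finite union of cubes contains another one, with closure in
G_n, at an arbitrarily small loss of covering cost (`exists_finset_dyadicCube_subset`). Iterating
gives nested compact sets with intersection inside limsup E_i. Compactness turns their uniform
covering cost into positive t-dimensional Hausdorff measure.

Packing dimension. Inside the open cube limsup E_i is a countable intersection of dense open sets.
By Baire, some member of any countable cover of it is dense in a nonempty open set, and such a set
has infinite packing premeasure in every dimension u < d. The upper bound d compares packings with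
volume. -/

/-! ### Dyadic cubes -/

/-- The half-open dyadic cube of side `2⁻ᵐ` and lower corner `2⁻ᵐ k`, where `q = (m, k)`. -/
def dyadicCube {d : ℕ} (q : ℕ × (Fin d → ℤ)) : Set (EuclideanSpace ℝ (Fin d)) :=
  {x | ∀ j, ⌊(2 : ℝ) ^ q.1 * x j⌋ = q.2 j}

/-- The dyadic cube of level `m` which contains `x`. -/
noncomputable def dyadicIndex {d : ℕ} (m : ℕ) (x : EuclideanSpace ℝ (Fin d)) :
    ℕ × (Fin d → ℤ) :=
  (m, fun j => ⌊(2 : ℝ) ^ m * x j⌋)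

/-- `IsSubcube p q`: the dyadic cube `p` is at least as deep as `q` and contained in it. -/
def IsSubcube {d : ℕ} (p q : ℕ × (Fin d → ℤ)) : Prop :=
  q.1 ≤ p.1 ∧ dyadicCube p ⊆ dyadicCube q

section Cubes

variable {d : ℕ}

theorem mem_dyadicCube_dyadicIndex (m : ℕ) (x : EuclideanSpace ℝ (Fin d)) :
    x ∈ dyadicCube (dyadicIndex m x) := fun _ => rfl

theorem eq_dyadicIndex_of_mem {q : ℕ × (Fin d → ℤ)} {x : EuclideanSpace ℝ (Fin d)}
    (hx : x ∈ dyadicCube q) : q = dyadicIndex q.1 x :=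
  Prod.ext rfl (funext fun j => (hx j).symm)

theorem dyadicCube_nonempty (q : ℕ × (Fin d → ℤ)) : (dyadicCube q).Nonempty := by
  refine ⟨WithLp.toLp 2 fun j => (q.2 j : ℝ) / 2 ^ q.1, fun j => ?_⟩
  have h : (2 : ℝ) ^ q.1 * ((q.2 j : ℝ) / 2 ^ q.1) = q.2 j := by field_simp
  simp [h]

theorem IsSubcube.refl (q : ℕ × (Fin d → ℤ)) : IsSubcube q q := ⟨le_rfl, subset_rfl⟩

theorem IsSubcube.trans {p q q' : ℕ × (Fin d → ℤ)} (h : IsSubcube p q) (h' : IsSubcube q q') :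
    IsSubcube p q' := ⟨h'.1.trans h.1, h.2.trans h'.2⟩

/-- The index at a fine level determines the index at every coarser one, by integer division. This
is what makes dyadic cubes nested or disjoint. -/
theorem floor_two_pow_mul_eq {m n : ℕ} (h : m ≤ n) (a : ℝ) :
    ⌊(2 : ℝ) ^ m * a⌋ = ⌊(2 : ℝ) ^ n * a⌋ / ((2 ^ (n - m) : ℕ) : ℤ) := by
  rw [← Int.floor_div_natCast]
  congr 1
  obtain ⟨k, rfl⟩ := Nat.exists_eq_add_of_le h
  rw [Nat.add_sub_cancel_left]
  push_cast
  rw [pow_add]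
  field_simp

theorem isSubcube_of_mem {p q : ℕ × (Fin d → ℤ)} {x : EuclideanSpace ℝ (Fin d)}
    (hp : x ∈ dyadicCube p) (hq : x ∈ dyadicCube q) (h : q.1 ≤ p.1) : IsSubcube p q := by
  refine ⟨h, fun y hy j => ?_⟩
  rw [← hq j, floor_two_pow_mul_eq h, floor_two_pow_mul_eq h (x j), hp j, hy j]

/-- At each level up to that of `p` there is at most one candidate. The ultrafilter argument below
rests on this finiteness. -/
theorem finite_setOf_isSubcube (p : ℕ × (Fin d → ℤ)) : {q | IsSubcube p q}.Finite := by
  obtain ⟨x, hx⟩ := dyadicCube_nonempty p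
  refine ((Set.finite_Iic p.1).image fun m => dyadicIndex m x).subset fun q hq => ?_
  exact ⟨q.1, hq.1, (eq_dyadicIndex_of_mem (hq.2 hx)).symm⟩

theorem dyadicCube_subset_Icc (q : ℕ × (Fin d → ℤ)) : dyadicCube q ⊆
    {x | ∀ j, x j ∈ Set.Icc ((q.2 j : ℝ) / 2 ^ q.1) (((q.2 j : ℝ) + 1) / 2 ^ q.1)} := by
  intro x hx j
  obtain ⟨h1, h2⟩ := Int.floor_eq_iff.1 (hx j)
  have h0 : (0 : ℝ) < 2 ^ q.1 := by positivity
  exact ⟨by rw [div_le_iff₀ h0]; linarith, by rw [le_div_iff₀ h0]; linarith⟩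

theorem Ioo_subset_dyadicCube (q : ℕ × (Fin d → ℤ)) :
    {x : EuclideanSpace ℝ (Fin d) |
      ∀ j, x j ∈ Set.Ioo ((q.2 j : ℝ) / 2 ^ q.1) (((q.2 j : ℝ) + 1) / 2 ^ q.1)} ⊆
    dyadicCube q := by
  intro x hx j
  obtain ⟨h1, h2⟩ := hx j
  have h0 : (0 : ℝ) < 2 ^ q.1 := by positivity
  rw [div_lt_iff₀ h0] at h1
  rw [lt_div_iff₀ h0] at h2
  exact Int.floor_eq_iff.2 ⟨by linarith, by linarith⟩

theorem isClosed_setOf_forall_mem_Icc (a b : Fin d → ℝ) :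
    IsClosed {x : EuclideanSpace ℝ (Fin d) | ∀ j, x j ∈ Set.Icc (a j) (b j)} := by
  simp only [Set.ofPred_forall]
  refine isClosed_iInter fun j => ?_
  exact isClosed_Icc.preimage (by fun_prop : Continuous fun x : EuclideanSpace ℝ (Fin d) => x j)

theorem isOpen_setOf_forall_mem_Ioo (a b : Fin d → ℝ) :
    IsOpen {x : EuclideanSpace ℝ (Fin d) | ∀ j, x j ∈ Set.Ioo (a j) (b j)} := by
  simp only [Set.ofPred_forall]
  refine isOpen_iInter_of_finite fun j => ?_
  exact isOpen_Ioo.preimage (by fun_prop : Continuous fun x : EuclideanSpace ℝ (Fin d) => x j)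

theorem volume_setOf_forall_mem_Icc (a b : Fin d → ℝ) :
    volume {x : EuclideanSpace ℝ (Fin d) | ∀ j, x j ∈ Set.Icc (a j) (b j)} =
      ∏ j, ENNReal.ofReal (b j - a j) := by
  rw [← Real.volume_Icc_pi, ← (PiLp.volume_preserving_ofLp (Fin d)).measure_preimage
    measurableSet_Icc.nullMeasurableSet]
  congr 1
  ext x
  simp [Pi.le_def, forall_and]

theorem volume_setOf_forall_mem_Ioo (a b : Fin d → ℝ) :
    volume {x : EuclideanSpace ℝ (Fin d) | ∀ j, x j ∈ Set.Ioo (a j) (b j)} =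
      ∏ j, ENNReal.ofReal (b j - a j) := by
  rw [← Real.volume_pi_Ioo, ← (PiLp.volume_preserving_ofLp (Fin d)).measure_preimage
    (MeasurableSet.univ_pi fun _ => measurableSet_Ioo).nullMeasurableSet]
  congr 1
  ext x
  simp

theorem volume_unitCube : volume (unitCube d) = 1 := by
  rw [unitCube, volume_setOf_forall_mem_Icc]
  simp

theorem isClosed_unitCube : IsClosed (unitCube d) := isClosed_setOf_forall_mem_Icc _ _

theorem isBounded_unitCube : Bornology.IsBounded (unitCube d) := by
  refine (Metric.isBounded_closedBall (x := 0) (r := √d)).subset fun x hx => ?_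
  rw [mem_closedBall_zero_iff, EuclideanSpace.norm_eq]
  refine Real.sqrt_le_sqrt ?_
  calc ∑ j, ‖x j‖ ^ 2 ≤ ∑ _j : Fin d, (1 : ℝ) := by
        refine Finset.sum_le_sum fun j _ => ?_
        rw [Real.norm_eq_abs, abs_of_nonneg (hx j).1]
        nlinarith [(hx j).1, (hx j).2]
    _ = d := by simp

theorem dist_le_of_mem_dyadicCube {q : ℕ × (Fin d → ℤ)} {x y : EuclideanSpace ℝ (Fin d)}
    (hx : x ∈ dyadicCube q) (hy : y ∈ dyadicCube q) : dist x y ≤ √d * (2 ^ q.1)⁻¹ := by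
  rw [EuclideanSpace.dist_eq]
  refine Real.sqrt_le_iff.2 ⟨by positivity, ?_⟩
  calc ∑ j, dist (x j) (y j) ^ 2 ≤ ∑ _j : Fin d, (((2 : ℝ) ^ q.1)⁻¹) ^ 2 := by
        refine Finset.sum_le_sum fun j _ => ?_
        refine pow_le_pow_left₀ dist_nonneg ?_ 2
        have := Real.dist_le_of_mem_Icc (dyadicCube_subset_Icc q hx j)
          (dyadicCube_subset_Icc q hy j)
        calc _ ≤ _ := this
          _ = _ := by ring
    _ = (√d * (2 ^ q.1)⁻¹) ^ 2 := by
        rw [mul_pow, Real.sq_sqrt (Nat.cast_nonneg d)]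
        simp

/-! ### Weights of dyadic cubes and their relation to volume -/

/-- The weight `2^(-s m)` of a dyadic cube of level `m`. -/
noncomputable def dyadicWeight (s : ℝ) (m : ℕ) : ℝ≥0∞ := 2⁻¹ ^ (s * m)

theorem dyadicWeight_ne_top {s : ℝ} (m : ℕ) : dyadicWeight s m ≠ ∞ :=
  ENNReal.rpow_ne_top_of_ne_zero (by simp) (by simp)

theorem dyadicWeight_pos {s : ℝ} (m : ℕ) : 0 < dyadicWeight s m :=
  ENNReal.rpow_pos (by simp) (by simp)

theorem dyadicWeight_add (s t : ℝ) (m : ℕ) :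
    dyadicWeight (s + t) m = dyadicWeight s m * dyadicWeight t m := by
  rw [dyadicWeight, add_mul, ENNReal.rpow_add _ _ (by simp) (by simp)]; rfl

theorem dyadicWeight_anti {s : ℝ} (hs : 0 ≤ s) {m n : ℕ} (h : m ≤ n) :
    dyadicWeight s n ≤ dyadicWeight s m := by
  refine ENNReal.rpow_le_rpow_of_exponent_ge (by simp) ?_
  gcongr

theorem dyadicWeight_eq_pow (s : ℝ) (m : ℕ) : dyadicWeight s m = (2⁻¹ ^ s) ^ m := by
  rw [dyadicWeight, ENNReal.rpow_mul, ENNReal.rpow_natCast]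

theorem two_inv_rpow_lt_one {s : ℝ} (hs : 0 < s) : (2⁻¹ : ℝ≥0∞) ^ s < 1 :=
  ENNReal.rpow_lt_one (by simp) hs

theorem tendsto_dyadicWeight {s : ℝ} (hs : 0 < s) :
    Tendsto (dyadicWeight s) atTop (𝓝 0) := by
  simp only [funext (dyadicWeight_eq_pow s)]
  exact ENNReal.tendsto_pow_atTop_nhds_zero_of_lt_one (two_inv_rpow_lt_one hs)

theorem ofReal_two_pow_inv_rpow (s : ℝ) (m : ℕ) :
    ENNReal.ofReal ((2 ^ m)⁻¹) ^ s = dyadicWeight s m := by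
  rw [dyadicWeight, mul_comm, ENNReal.rpow_mul, ENNReal.rpow_natCast, ← inv_pow,
    ENNReal.ofReal_pow (by positivity), ENNReal.ofReal_inv_of_pos (by norm_num)]
  simp

theorem ofReal_two_pow_inv_pow (m : ℕ) :
    ENNReal.ofReal ((2 ^ m)⁻¹) ^ d = dyadicWeight d m := by
  rw [← ofReal_two_pow_inv_rpow, ENNReal.rpow_natCast]

theorem volume_Icc_dyadic (q : ℕ × (Fin d → ℤ)) :
    volume {x : EuclideanSpace ℝ (Fin d) |
      ∀ j, x j ∈ Set.Icc ((q.2 j : ℝ) / 2 ^ q.1) (((q.2 j : ℝ) + 1) / 2 ^ q.1)} =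
    dyadicWeight d q.1 := by
  rw [volume_setOf_forall_mem_Icc, ← ofReal_two_pow_inv_pow]
  simp [← sub_div]

theorem volume_Ioo_dyadic (q : ℕ × (Fin d → ℤ)) :
    volume {x : EuclideanSpace ℝ (Fin d) |
      ∀ j, x j ∈ Set.Ioo ((q.2 j : ℝ) / 2 ^ q.1) (((q.2 j : ℝ) + 1) / 2 ^ q.1)} =
    dyadicWeight d q.1 := by
  rw [volume_setOf_forall_mem_Ioo, ← ofReal_two_pow_inv_pow]
  simp [← sub_div]

/-- Every point of an open set has arbitrarily deep dyadic cubes whose closure stays inside. -/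
theorem exists_closure_dyadicCube_subset {U : Set (EuclideanSpace ℝ (Fin d))} (hU : IsOpen U)
    {x : EuclideanSpace ℝ (Fin d)} (hx : x ∈ U) (m : ℕ) :
    ∃ n, m ≤ n ∧ closure (dyadicCube (dyadicIndex n x)) ⊆ U := by
  obtain ⟨ε, hε, h⟩ := Metric.nhds_basis_closedBall.mem_iff.1 (hU.mem_nhds hx)
  have hlim : Tendsto (fun n : ℕ => √d * ((2 : ℝ) ^ n)⁻¹) atTop (𝓝 (√d * 0)) := by
    simp only [← inv_pow]
    exact (tendsto_pow_atTop_nhds_zero_of_lt_one (by norm_num) (by norm_num)).const_mul _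
  rw [mul_zero] at hlim
  obtain ⟨n, hn, hmn⟩ := ((hlim.eventually_lt_const hε).and (eventually_ge_atTop m)).exists
  refine ⟨n, hmn, (closure_minimal ?_ Metric.isClosed_closedBall).trans h⟩
  intro y hy
  exact (dist_le_of_mem_dyadicCube hy (mem_dyadicCube_dyadicIndex n x)).trans hn.le

/-! ### Covering costs and saturated sets -/

/-- The total weight of a family of dyadic cubes. -/
noncomputable def netCost (t : ℝ) (C : Set (ℕ × (Fin d → ℤ))) : ℝ≥0∞ :=
  ∑' q : C, dyadicWeight t q.1.1

theorem netCost_mono {t : ℝ} {C C' : Set (ℕ × (Fin d → ℤ))} (h : C ⊆ C') :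
    netCost t C ≤ netCost t C' :=
  ENNReal.tsum_mono_subtype (fun q : ℕ × (Fin d → ℤ) => dyadicWeight t q.1) h

theorem netCost_singleton {t : ℝ} (q : ℕ × (Fin d → ℤ)) :
    netCost t {q} = dyadicWeight t q.1 :=
  tsum_singleton q fun q : ℕ × (Fin d → ℤ) => dyadicWeight t q.1

theorem netCost_union_le {t : ℝ} (C C' : Set (ℕ × (Fin d → ℤ))) :
    netCost t (C ∪ C') ≤ netCost t C + netCost t C' :=
  ENNReal.tsum_union_le (fun q : ℕ × (Fin d → ℤ) => dyadicWeight t q.1) C C'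

theorem netCost_union {t : ℝ} {C C' : Set (ℕ × (Fin d → ℤ))} (h : Disjoint C C') :
    netCost t (C ∪ C') = netCost t C + netCost t C' :=
  Summable.tsum_union_disjoint (f := fun q : ℕ × (Fin d → ℤ) => dyadicWeight t q.1) h
    ENNReal.summable ENNReal.summable

theorem dyadicWeight_le_netCost {t : ℝ} {C : Set (ℕ × (Fin d → ℤ))} {q : ℕ × (Fin d → ℤ)}
    (hq : q ∈ C) : dyadicWeight t q.1 ≤ netCost t C := by
  rw [← netCost_singleton]
  exact netCost_mono (Set.singleton_subset_iff.2 hq)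

/-- A family of cubes which covers `A ∩ J` can be replaced by one which is not more expensive and
contains a cube around `J`, provided that `A ∩ J` is as expensive to cover as `J`. -/
theorem exists_netCost_le_of_cover {t : ℝ} {A : Set (EuclideanSpace ℝ (Fin d))}
    {J : ℕ × (Fin d → ℤ)}
    (hJ : ∀ C : Set (ℕ × (Fin d → ℤ)), A ∩ dyadicCube J ⊆ ⋃ q ∈ C, dyadicCube q →
      dyadicWeight t J.1 ≤ netCost t C)
    {C : Set (ℕ × (Fin d → ℤ))} (hC : A ∩ dyadicCube J ⊆ ⋃ q ∈ C, dyadicCube q) :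
    ∃ C' : Set (ℕ × (Fin d → ℤ)), netCost t C' ≤ netCost t C ∧
      (∃ q ∈ C', IsSubcube J q) ∧ ∀ p ∈ C, ∃ q ∈ C', IsSubcube p q := by
  by_cases h : ∃ q ∈ C, IsSubcube J q
  · exact ⟨C, le_rfl, h, fun p hp => ⟨p, hp, .refl p⟩⟩
  push Not at h
  -- No cube of `C` contains `J`, so by nestedness the cubes of `C` that meet `J` lie in `J`. They
  -- alone cover `A ∩ J`, and trading them for `J` does not raise the cost.
  set S := {q ∈ C | IsSubcube q J} with hS
  set R := {q ∈ C | ¬ IsSubcube q J} with hR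
  have hSR : C = S ∪ R := by ext q; simp only [hS, hR, Set.mem_union, Set.mem_ofPred_eq]; tauto
  have hdisj : Disjoint S R := Set.disjoint_left.2 fun q h1 h2 => h2.2 h1.2
  have hcov : A ∩ dyadicCube J ⊆ ⋃ q ∈ S, dyadicCube q := by
    intro x hx
    obtain ⟨q, hq, hxq⟩ := Set.mem_iUnion₂.1 (hC hx)
    refine Set.mem_iUnion₂.2 ⟨q, ⟨hq, ?_⟩, hxq⟩
    rcases le_total q.1 J.1 with hl | hl
    · exact absurd (isSubcube_of_mem hx.2 hxq hl) (h q hq)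
    · exact isSubcube_of_mem hxq hx.2 hl
  refine ⟨{J} ∪ R, ?_, ⟨J, by simp, .refl J⟩, fun p hp => ?_⟩
  · calc netCost t ({J} ∪ R) ≤ netCost t {J} + netCost t R := netCost_union_le _ _
      _ ≤ netCost t S + netCost t R := by
        rw [netCost_singleton]; gcongr; exact hJ S hcov
      _ = netCost t C := by rw [hSR, netCost_union hdisj]
  · by_cases hpJ : IsSubcube p J
    · exact ⟨J, by simp, hpJ⟩
    · exact ⟨p, Or.inr ⟨hp, hpJ⟩, .refl p⟩

theorem iUnion_dyadicCube_subset_of_refine {C C' : Set (ℕ × (Fin d → ℤ))}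
    (h : ∀ p ∈ C, ∃ q ∈ C', IsSubcube p q) :
    ⋃ q ∈ C, dyadicCube q ⊆ ⋃ q ∈ C', dyadicCube q := by
  refine Set.iUnion₂_subset fun p hp => ?_
  obtain ⟨q, hq, hpq⟩ := h p hp
  exact hpq.2.trans (Set.subset_biUnion_of_mem (u := fun q => dyadicCube q) hq)

/-- Simultaneous version of `exists_netCost_le_of_cover` for finitely many cubes. -/
theorem exists_netCost_le_of_cover_finset {t : ℝ} {A : Set (EuclideanSpace ℝ (Fin d))}
    (F : Finset (ℕ × (Fin d → ℤ)))
    (hF : ∀ J ∈ F, ∀ C : Set (ℕ × (Fin d → ℤ)), A ∩ dyadicCube J ⊆ ⋃ q ∈ C, dyadicCube q →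
      dyadicWeight t J.1 ≤ netCost t C)
    {C : Set (ℕ × (Fin d → ℤ))} (hC : ∀ J ∈ F, A ∩ dyadicCube J ⊆ ⋃ q ∈ C, dyadicCube q) :
    ∃ C' : Set (ℕ × (Fin d → ℤ)), netCost t C' ≤ netCost t C ∧
      (∀ J ∈ F, ∃ q ∈ C', IsSubcube J q) ∧ ∀ p ∈ C, ∃ q ∈ C', IsSubcube p q := by
  classical
  induction F using Finset.induction_on with
  | empty => exact ⟨C, le_rfl, by simp, fun p hp => ⟨p, hp, .refl p⟩⟩
  | insert J F _ ih =>
    obtain ⟨C₁, h1, h2, h3⟩ := ih (fun J hJ => hF J (Finset.mem_insert_of_mem hJ))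
      fun J hJ => hC J (Finset.mem_insert_of_mem hJ)
    obtain ⟨C₂, h4, h5, h6⟩ := exists_netCost_le_of_cover (hF J (Finset.mem_insert_self J F))
      ((hC J (Finset.mem_insert_self J F)).trans (iUnion_dyadicCube_subset_of_refine h3))
    refine ⟨C₂, h4.trans h1, ?_, ?_⟩
    · intro J' hJ'
      rcases Finset.mem_insert.1 hJ' with rfl | hJ'
      · exact h5
      · obtain ⟨q, hq, hJq⟩ := h2 J' hJ'
        obtain ⟨q', hq', hqq⟩ := h6 q hq
        exact ⟨q', hq', hJq.trans hqq⟩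
    · intro p hp
      obtain ⟨q, hq, hpq⟩ := h3 p hp
      obtain ⟨q', hq', hqq⟩ := h6 q hq
      exact ⟨q', hq', hpq.trans hqq⟩

/-- The limit of families of cubes along an ultrafilter costs at most as much as the families. -/
theorem netCost_ultrafilter_limit_le {t : ℝ} {ι : Type*} (U : Ultrafilter ι)
    {C : ι → Set (ℕ × (Fin d → ℤ))} {a : ℝ≥0∞} (h : ∀ i, netCost t (C i) ≤ a) :
    netCost t {q | ∀ᶠ i in (U : Filter ι), q ∈ C i} ≤ a := by
  rw [netCost, ENNReal.tsum_eq_iSup_sum]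
  refine iSup_le fun T => ?_
  -- A finite part of the limit family lies in a single `C i`, so each partial sum is bounded by
  -- `a`.
  have hT : ∀ᶠ i in (U : Filter ι), ∀ q ∈ T, q.1 ∈ C i := (Finset.eventually_all T).2 fun q _ => q.2
  obtain ⟨i, hi⟩ := hT.exists
  refine le_trans ?_ (h i)
  let T' := T.map (Function.Embedding.subtype _)
  calc ∑ q ∈ T, dyadicWeight t q.1.1 = ∑ q ∈ T', dyadicWeight t q.1 := by
        rw [Finset.sum_map]; rfl
    _ = netCost t (T' : Set (ℕ × (Fin d → ℤ))) :=
        (Finset.tsum_subtype T' fun q : ℕ × (Fin d → ℤ) => dyadicWeight t q.1).symm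
    _ ≤ netCost t (C i) := netCost_mono fun q hq => by
        obtain ⟨p, hp, rfl⟩ := Finset.mem_map.1 (Finset.mem_coe.1 hq)
        exact hi p hp

end Cubes

/-! ### Intersections of saturated open sets -/

section Intersection

variable {d : ℕ}

/-- If the traces of `G` on the cubes of `F` are as expensive to cover as the cubes themselves,
then a finite union of cubes inside `G` is almost as expensive to cover as the union of `F`. -/
theorem exists_finset_dyadicCube_subset {t : ℝ} {G : Set (EuclideanSpace ℝ (Fin d))}
    (hG : IsOpen G) {Q : Set (EuclideanSpace ℝ (Fin d))}
    (hsat : ∀ J : ℕ × (Fin d → ℤ), dyadicCube J ⊆ Q → ∀ C : Set (ℕ × (Fin d → ℤ)),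
      G ∩ dyadicCube J ⊆ ⋃ q ∈ C, dyadicCube q → dyadicWeight t J.1 ≤ netCost t C)
    (F : Finset (ℕ × (Fin d → ℤ))) (hFQ : ∀ J ∈ F, dyadicCube J ⊆ Q) {a a' : ℝ≥0∞}
    (haa : a' < a)
    (ha : ∀ C : Set (ℕ × (Fin d → ℤ)), ⋃ J ∈ F, dyadicCube J ⊆ ⋃ q ∈ C, dyadicCube q →
      a ≤ netCost t C) :
    ∃ F' : Finset (ℕ × (Fin d → ℤ)), (∀ J ∈ F', closure (dyadicCube J) ⊆ G) ∧
      (∀ J ∈ F', ∃ I ∈ F, dyadicCube J ⊆ dyadicCube I) ∧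
      ∀ C : Set (ℕ × (Fin d → ℤ)), ⋃ J ∈ F', dyadicCube J ⊆ ⋃ q ∈ C, dyadicCube q →
        a' ≤ netCost t C := by
  classical
  by_contra! hcon
  set good : Set (ℕ × (Fin d → ℤ)) :=
    {J | closure (dyadicCube J) ⊆ G ∧ ∃ I ∈ F, dyadicCube J ⊆ dyadicCube I} with hgood
  -- If the claim fails, every finite family of good cubes has a cover of cost below `a'`.
  -- Saturation upgrades it to a family containing an ancestor of each cube, at no extra cost.
  have key : ∀ T : Finset good, ∃ C : Set (ℕ × (Fin d → ℤ)), netCost t C ≤ a' ∧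
      ∀ J ∈ T, ∃ q ∈ C, IsSubcube J.1 q := by
    intro T
    obtain ⟨C, hC, hCa⟩ := hcon (T.image Subtype.val)
      (by
        intro J hJ
        obtain ⟨J, -, rfl⟩ := Finset.mem_image.1 hJ
        exact J.2.1)
      (by
        intro J hJ
        obtain ⟨J, -, rfl⟩ := Finset.mem_image.1 hJ
        exact J.2.2)
    obtain ⟨C', h1, h2, -⟩ := exists_netCost_le_of_cover_finset (A := G) (t := t)
      (T.image Subtype.val)
      (by
        intro J hJ
        obtain ⟨J, -, rfl⟩ := Finset.mem_image.1 hJ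
        obtain ⟨I, hI, hJI⟩ := J.2.2
        exact hsat J.1 (hJI.trans (hFQ I hI)))
      (C := C) fun J hJ => Set.inter_subset_right.trans
        ((Set.subset_biUnion_of_mem (u := fun q => dyadicCube q) hJ).trans hC)
    exact ⟨C', h1.trans hCa.le, fun J hJ => h2 J.1 (Finset.mem_image_of_mem _ hJ)⟩
  choose C hC hCsub using key
  let U : Ultrafilter (Finset good) := Ultrafilter.of atTop
  have hU : (U : Filter (Finset good)) ≤ atTop := Ultrafilter.of_le _
  set L : Set (ℕ × (Fin d → ℤ)) := {q | ∀ᶠ T in (U : Filter (Finset good)), q ∈ C T} with hL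
  have hLcost : netCost t L ≤ a' := netCost_ultrafilter_limit_le U hC
  have hLgood : ∀ J ∈ good, ∃ q ∈ L, IsSubcube J q := by
    intro J hJ
    have hev : ∀ᶠ T in (U : Filter (Finset good)), ∃ q ∈ {q | IsSubcube J q}, q ∈ C T := by
      refine hU ?_
      filter_upwards [eventually_ge_atTop {(⟨J, hJ⟩ : good)}] with T hT
      obtain ⟨q, hq, hJq⟩ := hCsub T ⟨J, hJ⟩ (hT (Finset.mem_singleton_self _))
      exact ⟨q, hJq, hq⟩
    -- `J` has only finitely many ancestors, so the ultrafilter selects one that lies in `C T` for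
    -- almost all `T`.
    have hmem : (⋃ q ∈ {q | IsSubcube J q}, {T | q ∈ C T}) ∈ U := by
      filter_upwards [hev] with T hT
      obtain ⟨q, hq, hqT⟩ := hT
      exact Set.mem_iUnion₂.2 ⟨q, hq, hqT⟩
    obtain ⟨q, hq, hqL⟩ :=
      (Ultrafilter.finite_biUnion_mem_iff (finite_setOf_isSubcube J)).1 hmem
    exact ⟨q, hqL, hq⟩
  have hLcov : ∀ J ∈ F, G ∩ dyadicCube J ⊆ ⋃ q ∈ L, dyadicCube q := by
    intro J hJ x hx
    obtain ⟨n, hn, hnG⟩ := exists_closure_dyadicCube_subset hG hx.1 J.1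
    have hsub : IsSubcube (dyadicIndex n x) J :=
      isSubcube_of_mem (mem_dyadicCube_dyadicIndex n x) hx.2 hn
    obtain ⟨q, hq, hqs⟩ := hLgood _ ⟨hnG, J, hJ, hsub.2⟩
    exact Set.mem_iUnion₂.2 ⟨q, hq, hqs.2 (mem_dyadicCube_dyadicIndex n x)⟩
  -- The limit family covers only the part of the cubes of `F` inside `G`. Saturation, used once
  -- more, makes it swallow these cubes entirely, at cost at most `a' < a`.
  obtain ⟨C', h1, h2, -⟩ := exists_netCost_le_of_cover_finset (A := G) (t := t) F
    (fun J hJ => hsat J (hFQ J hJ)) hLcov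
  refine absurd ((ha C' (Set.iUnion₂_subset fun J hJ => ?_)).trans (h1.trans hLcost)) haa.not_ge
  obtain ⟨q, hq, hJq⟩ := h2 J hJ
  exact hJq.2.trans (Set.subset_biUnion_of_mem (u := fun q => dyadicCube q) hq)

/-- If each `G n` is as expensive to cover as `Q` in every cube inside `Q`, then `⋂ n, G n` contains
a decreasing intersection of nonempty compact sets that are uniformly expensive to cover. -/
theorem exists_compact_seq_of_saturated {t : ℝ} {G : ℕ → Set (EuclideanSpace ℝ (Fin d))}
    (hG : ∀ n, IsOpen (G n)) {Q : Set (EuclideanSpace ℝ (Fin d))}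
    (hQ : Bornology.IsBounded Q)
    (hsat : ∀ n, ∀ J : ℕ × (Fin d → ℤ), dyadicCube J ⊆ Q → ∀ C : Set (ℕ × (Fin d → ℤ)),
      G n ∩ dyadicCube J ⊆ ⋃ q ∈ C, dyadicCube q → dyadicWeight t J.1 ≤ netCost t C)
    {J₀ : ℕ × (Fin d → ℤ)} (hJ₀ : dyadicCube J₀ ⊆ Q) {b : ℝ≥0∞} (hb : b < dyadicWeight t J₀.1) :
    ∃ K : ℕ → Set (EuclideanSpace ℝ (Fin d)), (∀ n, IsCompact (K n)) ∧ Antitone K ∧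
      (⋂ n, K n) ⊆ ⋂ n, G n ∧ ∀ n, ∀ C : Set (ℕ × (Fin d → ℤ)),
        K n ⊆ ⋃ q ∈ C, dyadicCube q → b ≤ netCost t C := by
  -- The strict inequality `b < a` leaves room for a small loss at each of infinitely many steps.
  let P : Finset (ℕ × (Fin d → ℤ)) → Prop := fun F => (∀ J ∈ F, dyadicCube J ⊆ Q) ∧
    ∃ a, b < a ∧ ∀ C : Set (ℕ × (Fin d → ℤ)), ⋃ J ∈ F, dyadicCube J ⊆ ⋃ q ∈ C, dyadicCube q →
      a ≤ netCost t C
  have step : ∀ n, ∀ F : {F // P F}, ∃ F' : {F // P F},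
      (∀ J ∈ F'.1, closure (dyadicCube J) ⊆ G n) ∧
      ∀ J ∈ F'.1, ∃ I ∈ F.1, dyadicCube J ⊆ dyadicCube I := by
    rintro n ⟨F, hFQ, a, hba, ha⟩
    obtain ⟨a', hba', haa⟩ := exists_between hba
    obtain ⟨F', h1, h2, h3⟩ :=
      exists_finset_dyadicCube_subset (hG n) (hsat n) F hFQ haa ha
    refine ⟨⟨F', fun J hJ => ?_, a', hba', h3⟩, h1, h2⟩
    obtain ⟨I, hI, hJI⟩ := h2 J hJ
    exact hJI.trans (hFQ I hI)
  choose next hnext1 hnext2 using step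
  have hP₀ : P {J₀} := by
    refine ⟨by simpa using hJ₀, _, hb, fun C hC => hsat 0 J₀ hJ₀ C ?_⟩
    simp only [Finset.mem_singleton, Set.iUnion_iUnion_eq_left] at hC
    exact Set.inter_subset_right.trans hC
  let F : ℕ → {F // P F} := fun n => Nat.rec ⟨{J₀}, hP₀⟩ next n
  have hF : ∀ n, F (n + 1) = next n (F n) := fun n => rfl
  refine ⟨fun n => closure (⋃ J ∈ (F n).1, dyadicCube J), fun n => ?_, ?_, ?_, ?_⟩
  · exact (hQ.subset (Set.iUnion₂_subset (F n).2.1)).isCompact_closure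
  · refine antitone_nat_of_succ_le fun n => closure_mono (Set.iUnion₂_subset fun J hJ => ?_)
    rw [hF] at hJ
    obtain ⟨I, hI, hJI⟩ := hnext2 n (F n) J hJ
    exact hJI.trans (Set.subset_biUnion_of_mem (u := fun q => dyadicCube q) hI)
  · refine Set.subset_iInter fun n => (Set.iInter_subset _ (n + 1)).trans ?_
    rw [hF, Finset.closure_biUnion]
    exact Set.iUnion₂_subset (hnext1 n (F n))
  · intro n C hC
    obtain ⟨a, hba, ha⟩ := (F n).2.2
    exact hba.le.trans (ha C (subset_closure.trans hC))

end Intersection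

/-! ### Saturation of the tail unions -/

section Saturation

variable {d : ℕ}

/-- A countable index set is padded to `ℕ` by balls of radius 0, which are free because 0 < s. -/
theorem hausdorffContent_le_tsum {s : ℝ} (hs : 0 < s) {A : Set (EuclideanSpace ℝ (Fin d))}
    {ι : Type*} [Countable ι] (x : ι → EuclideanSpace ℝ (Fin d)) (ρ : ι → ℝ≥0)
    (h : A ⊆ ⋃ i, Metric.closedBall (x i) (ρ i)) :
    hausdorffContent s A ≤ ∑' i, (2 * (ρ i : ℝ≥0∞)) ^ s := by
  obtain ⟨f, hf⟩ := exists_injective_nat ι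
  let x' : ℕ → EuclideanSpace ℝ (Fin d) := Function.extend f x fun _ => 0
  let ρ' : ℕ → ℝ≥0 := Function.extend f ρ fun _ => 0
  have hx' : ∀ i, x' (f i) = x i := fun i => hf.extend_apply _ _ _
  have hρ' : ∀ i, ρ' (f i) = ρ i := fun i => hf.extend_apply _ _ _
  have hcov : A ⊆ ⋃ n, Metric.closedBall (x' n) (ρ' n) := by
    refine h.trans (Set.iUnion_subset fun i => ?_)
    rw [← hx' i, ← hρ' i]
    exact Set.subset_iUnion (fun n => Metric.closedBall (x' n) (ρ' n)) (f i)
  have hle : hausdorffContent s A ≤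
      ∑' n, Metric.ediam (Metric.closedBall (x' n) (ρ' n : ℝ)) ^ s :=
    iInf₂_le_of_le x' ρ' (iInf_le_of_le hcov le_rfl)
  refine hle.trans ?_
  rw [← hf.tsum_eq]
  · refine ENNReal.tsum_le_tsum fun i => ?_
    rw [hx', hρ']
    refine ENNReal.rpow_le_rpow ?_ hs.le
    rw [← Metric.closedEBall_coe]
    exact Metric.ediam_closedEBall_le
  · intro n hn
    by_contra hnf
    have h0 : ρ' n = 0 := Function.extend_apply' _ _ _ hnf
    refine hn ?_
    simp [h0, hs]

variable {B E : ℕ → Set (EuclideanSpace ℝ (Fin d))} {c : ℕ → EuclideanSpace ℝ (Fin d)} {r : ℕ → ℝ}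

theorem subset_closedBall_of_eq_ball_or {A : Set (EuclideanSpace ℝ (Fin d))}
    {x : EuclideanSpace ℝ (Fin d)} {ρ : ℝ}
    (h : A = Metric.ball x ρ ∨ A = Metric.closedBall x ρ) : A ⊆ Metric.closedBall x ρ := by
  rcases h with rfl | rfl
  · exact Metric.ball_subset_closedBall
  · exact subset_rfl

theorem ball_subset_of_eq_ball_or {A : Set (EuclideanSpace ℝ (Fin d))}
    {x : EuclideanSpace ℝ (Fin d)} {ρ : ℝ}
    (h : A = Metric.ball x ρ ∨ A = Metric.closedBall x ρ) : Metric.ball x ρ ⊆ A := by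
  rcases h with rfl | rfl
  · exact subset_rfl
  · exact Metric.ball_subset_closedBall

theorem measurableSet_of_eq_ball_or {A : Set (EuclideanSpace ℝ (Fin d))}
    {x : EuclideanSpace ℝ (Fin d)} {ρ : ℝ}
    (h : A = Metric.ball x ρ ∨ A = Metric.closedBall x ρ) : MeasurableSet A := by
  rcases h with rfl | rfl
  · exact measurableSet_ball
  · exact measurableSet_closedBall

theorem volume_of_eq_ball_or {A : Set (EuclideanSpace ℝ (Fin d))}
    {x : EuclideanSpace ℝ (Fin d)} {ρ : ℝ} (hρ : 0 < ρ)
    (h : A = Metric.ball x ρ ∨ A = Metric.closedBall x ρ) :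
    volume A = ENNReal.ofReal (ρ ^ d) *
      volume (Metric.ball (0 : EuclideanSpace ℝ (Fin d)) 1) := by
  rcases h with rfl | rfl
  · rw [Measure.addHaar_ball_of_pos _ _ hρ, finrank_euclideanSpace_fin]
  · rw [Measure.addHaar_closedBall _ _ hρ.le, finrank_euclideanSpace_fin]

/-- Near almost every point of the cube there are balls `B i` with large index in any given
neighbourhood. -/
theorem volume_le_volume_iUnion_of_limsup
    (hB : ∀ i, B i = Metric.ball (c i) (r i) ∨ B i = Metric.closedBall (c i) (r i))
    (hcube : ∀ i, B i ⊆ unitCube d) (hr0 : Tendsto r atTop (𝓝 0))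
    (hfull : volume (limsup B atTop) = 1)
    {O : Set (EuclideanSpace ℝ (Fin d))} (hO : IsOpen O) (hOc : O ⊆ unitCube d) (n : ℕ) :
    volume O ≤ volume (⋃ i ∈ {i | n ≤ i ∧ B i ⊆ O}, B i) := by
  have hlim : limsup B atTop ⊆ unitCube d := fun x hx => by
    obtain ⟨i, hi⟩ := (mem_limsup_iff_frequently_mem.1 hx).exists
    exact hcube i hi
  have hae : volume (unitCube d \ limsup B atTop) = 0 := by
    rw [measure_sdiff hlim (MeasurableSet.measurableSet_limsup fun i =>
      measurableSet_of_eq_ball_or (hB i)).nullMeasurableSet (by simp [hfull]), hfull,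
      volume_unitCube, tsub_self]
  have hsub : O ⊆ (⋃ i ∈ {i | n ≤ i ∧ B i ⊆ O}, B i) ∪ (unitCube d \ limsup B atTop) := by
    intro x hx
    by_cases hxl : x ∈ limsup B atTop
    · left
      obtain ⟨ε, hε, hεO⟩ := Metric.isOpen_iff.1 hO x hx
      obtain ⟨i, hxi, hri, hni⟩ := ((mem_limsup_iff_frequently_mem.1 hxl).and_eventually
        ((hr0.eventually_lt_const (half_pos hε)).and (eventually_ge_atTop n))).exists
      refine Set.mem_iUnion₂.2 ⟨i, ⟨hni, fun y hy => hεO ?_⟩, hxi⟩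
      have h1 := Metric.mem_closedBall.1 (subset_closedBall_of_eq_ball_or (hB i) hxi)
      have h2 := Metric.mem_closedBall.1 (subset_closedBall_of_eq_ball_or (hB i) hy)
      rw [Metric.mem_ball]
      linarith [dist_triangle_right y x (c i)]
    · exact Or.inr ⟨hOc hx, hxl⟩
  calc volume O ≤ _ := measure_mono hsub
    _ ≤ _ := measure_union_le _ _
    _ = _ := by rw [hae, add_zero]

/-- Vitali's covering lemma is applied to the doubled balls, hence 10 = 5 · 2. Disjointness of the
doubles prevents a small cube from touching two of the chosen balls. -/
theorem exists_disjoint_balls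
    (hr : ∀ i, 0 < r i)
    (hB : ∀ i, B i = Metric.ball (c i) (r i) ∨ B i = Metric.closedBall (c i) (r i))
    (hcube : ∀ i, B i ⊆ unitCube d) (hr0 : Tendsto r atTop (𝓝 0))
    (hfull : volume (limsup B atTop) = 1)
    {O : Set (EuclideanSpace ℝ (Fin d))} (hO : IsOpen O) (hOc : O ⊆ unitCube d) (n : ℕ) :
    ∃ I : Set ℕ, (∀ i ∈ I, n ≤ i ∧ B i ⊆ O) ∧
      (I.PairwiseDisjoint fun i => Metric.closedBall (c i) (2 * r i)) ∧
      volume O ≤ 10 ^ d * ∑' i : I, volume (B i) := by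
  obtain ⟨R, hR⟩ := hr0.bddAbove_range
  obtain ⟨I, hIT, hdisj, hcov⟩ := Vitali.exists_disjoint_subfamily_covering_enlargement_closedBall
    {i | n ≤ i ∧ B i ⊆ O} c (fun i => 2 * r i) (2 * R)
    (fun i _ => by have := hR (Set.mem_range_self i); linarith) 5 (by norm_num)
  refine ⟨I, fun i hi => hIT hi, hdisj, ?_⟩
  have hball : ∀ i, volume (Metric.closedBall (c i) (5 * (2 * r i))) = 10 ^ d * volume (B i) := by
    intro i
    have := hr i
    rw [volume_of_eq_ball_or (hr i) (hB i), Measure.addHaar_closedBall _ _ (by positivity),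
      finrank_euclideanSpace_fin, show 5 * (2 * r i) = 10 * r i by ring, mul_pow,
      ← mul_assoc, ENNReal.ofReal_mul (by positivity), ENNReal.ofReal_pow (by norm_num)]
    simp
  calc volume O ≤ volume (⋃ i ∈ {i | n ≤ i ∧ B i ⊆ O}, B i) :=
        volume_le_volume_iUnion_of_limsup hB hcube hr0 hfull hO hOc n
    _ ≤ volume (⋃ i : I, Metric.closedBall (c i) (5 * (2 * r i))) := by
        refine measure_mono (Set.iUnion₂_subset fun i hi => ?_)
        obtain ⟨b, hb, hib⟩ := hcov i hi
        refine (subset_closedBall_of_eq_ball_or (hB i)).trans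
          ((Metric.closedBall_subset_closedBall (by linarith [hr i])).trans (hib.trans ?_))
        exact Set.subset_iUnion (fun i : I => Metric.closedBall (c i) (5 * (2 * r i))) ⟨b, hb⟩
    _ ≤ ∑' i : I, volume (Metric.closedBall (c i) (5 * (2 * r i))) := measure_iUnion_le _
    _ = 10 ^ d * ∑' i : I, volume (B i) := by simp only [hball, ENNReal.tsum_mul_left]

/-- Disjoint balls that touch a cube and have radius at most its diameter all lie in a ball three
times that size, so their total volume is comparable to that of the cube. -/
theorem tsum_volume_touching_le
    (hr : ∀ i, 0 < r i)
    (hB : ∀ i, B i = Metric.ball (c i) (r i) ∨ B i = Metric.closedBall (c i) (r i))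
    {I : Set ℕ} (hI : I.PairwiseDisjoint fun i => Metric.closedBall (c i) (2 * r i))
    (q : ℕ × (Fin d → ℤ)) [DecidablePred fun i : I =>
      (dyadicCube q ∩ B i).Nonempty ∧ r i ≤ √d * (2 ^ q.1)⁻¹] :
    ∑' i : I, (if (dyadicCube q ∩ B i).Nonempty ∧ r i ≤ √d * (2 ^ q.1)⁻¹ then
      volume (B i) else 0) ≤ ENNReal.ofReal ((3 * √d) ^ d) *
        volume (Metric.ball (0 : EuclideanSpace ℝ (Fin d)) 1) * dyadicWeight d q.1 := by
  let S : I → Set (EuclideanSpace ℝ (Fin d)) := fun i =>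
    if (dyadicCube q ∩ B i).Nonempty ∧ r i ≤ √d * (2 ^ q.1)⁻¹ then B i else ∅
  have hS : ∀ i : I, (if (dyadicCube q ∩ B i).Nonempty ∧ r i ≤ √d * (2 ^ q.1)⁻¹ then
      volume (B i) else 0) = volume (S i) := fun i => by
    simp only [S]; split_ifs <;> simp
  have hSB : ∀ i, S i ⊆ Metric.closedBall (c i) (2 * r i) := fun i => by
    simp only [S]
    split_ifs
    · exact (subset_closedBall_of_eq_ball_or (hB i)).trans
        (Metric.closedBall_subset_closedBall (by linarith [hr i]))
    · exact Set.empty_subset _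
  obtain ⟨x, hx⟩ := dyadicCube_nonempty q
  simp only [hS]
  calc ∑' i, volume (S i) ≤ volume (⋃ i, S i) := by
        refine tsum_meas_le_meas_iUnion_of_disjoint _ (fun i => ?_) fun i j hij => ?_
        · simp only [S]
          split_ifs
          · exact measurableSet_of_eq_ball_or (hB i)
          · exact MeasurableSet.empty
        · exact (hI i.2 j.2 (fun h => hij (Subtype.ext h))).mono (hSB i) (hSB j)
    _ ≤ volume (Metric.closedBall x (3 * √d * (2 ^ q.1)⁻¹)) := by
        refine measure_mono (Set.iUnion_subset fun i z hz => ?_)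
        simp only [S] at hz
        split_ifs at hz with h
        · obtain ⟨⟨y, hyq, hyB⟩, hri⟩ := h
          have h1 := Metric.mem_closedBall.1 (subset_closedBall_of_eq_ball_or (hB i) hyB)
          have h2 := Metric.mem_closedBall.1 (subset_closedBall_of_eq_ball_or (hB i) hz)
          have h3 := dist_le_of_mem_dyadicCube hyq hx
          rw [Metric.mem_closedBall]
          linarith [dist_triangle_right z y (c i), dist_triangle z y x]
        · exact hz.elim
    _ = _ := by
        rw [Measure.addHaar_closedBall _ _ (by positivity), finrank_euclideanSpace_fin, mul_pow,
          ENNReal.ofReal_mul (by positivity),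
          ENNReal.ofReal_pow (p := (2 ^ q.1)⁻¹) (by positivity) d,
          ofReal_two_pow_inv_pow]
        ring

/-- A cube touching `B i` with diameter below `r i` lies in the doubled ball, so at most one `i`
contributes. -/
theorem tsum_weight_touching_le
    (hB : ∀ i, B i = Metric.ball (c i) (r i) ∨ B i = Metric.closedBall (c i) (r i))
    {I : Set ℕ} (hI : I.PairwiseDisjoint fun i => Metric.closedBall (c i) (2 * r i))
    (q : ℕ × (Fin d → ℤ)) (a : ℝ≥0∞) [DecidablePred fun i : I =>
      (dyadicCube q ∩ B i).Nonempty ∧ √d * (2 ^ q.1)⁻¹ < r i] :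
    ∑' i : I, (if (dyadicCube q ∩ B i).Nonempty ∧ √d * (2 ^ q.1)⁻¹ < r i then a else 0) ≤ a := by
  obtain ⟨x, hx⟩ := dyadicCube_nonempty q
  have hmem : ∀ i : I, (dyadicCube q ∩ B i).Nonempty ∧ √d * (2 ^ q.1)⁻¹ < r i →
      x ∈ Metric.closedBall (c i) (2 * r i) := by
    rintro i ⟨⟨y, hyq, hyB⟩, hri⟩
    have h1 := Metric.mem_closedBall.1 (subset_closedBall_of_eq_ball_or (hB i) hyB)
    have h3 := dist_le_of_mem_dyadicCube hx hyq
    rw [Metric.mem_closedBall]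
    linarith [dist_triangle x y (c i)]
  by_cases h : ∃ i : I, (dyadicCube q ∩ B i).Nonempty ∧ √d * (2 ^ q.1)⁻¹ < r i
  · obtain ⟨i, hi⟩ := h
    rw [tsum_eq_single i, if_pos hi]
    intro j hji
    refine if_neg fun hj => ?_
    exact Set.disjoint_left.1 (hI j.2 i.2 fun h => hji (Subtype.ext h)) (hmem j hj) (hmem i hi)
  · push Not at h
    rw [ENNReal.tsum_eq_zero.2 fun i => if_neg fun hi => (h i hi.1).not_gt hi.2]
    exact zero_le

/-- A family of deep cubes covering the tail union of the `E i` inside an open set `O` is expensive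
compared with the volume of `O`. -/
theorem exists_volume_le_mul_netCost
    (hr : ∀ i, 0 < r i)
    (hB : ∀ i, B i = Metric.ball (c i) (r i) ∨ B i = Metric.closedBall (c i) (r i))
    (hcube : ∀ i, B i ⊆ unitCube d) (hr0 : Tendsto r atTop (𝓝 0))
    (hfull : volume (limsup B atTop) = 1) {s : ℝ} (hs0 : 0 < s) (hsd : s < d)
    (hEB : ∀ i, E i ⊆ B i) (hcontent : ∀ i, volume (B i) ≤ hausdorffContent s (E i))
    {t : ℝ} (hts : t < s) :
    ∃ K : ℝ≥0∞, K ≠ ∞ ∧ ∀ (n m : ℕ) (O : Set (EuclideanSpace ℝ (Fin d))), IsOpen O →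
      O ⊆ unitCube d → ∀ C : Set (ℕ × (Fin d → ℤ)), (∀ q ∈ C, m ≤ q.1) →
      (⋃ i ≥ n, E i) ∩ O ⊆ ⋃ q ∈ C, dyadicCube q →
      volume O ≤ K * dyadicWeight (s - t) m * netCost t C := by
  classical
  set κ : ℝ≥0∞ := ENNReal.ofReal ((3 * √d) ^ d) *
    volume (Metric.ball (0 : EuclideanSpace ℝ (Fin d)) 1) with hκ
  set D : ℝ≥0∞ := (2 * ENNReal.ofReal √d) ^ s with hD
  have hκtop : κ ≠ ∞ := ENNReal.mul_ne_top ENNReal.ofReal_ne_top measure_ball_lt_top.ne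
  have hDtop : D ≠ ∞ := ENNReal.rpow_ne_top_of_nonneg hs0.le
    (ENNReal.mul_ne_top (by simp) ENNReal.ofReal_ne_top)
  refine ⟨10 ^ d * (κ + D), ENNReal.mul_ne_top (by simp) (by simp [hκtop, hDtop]), ?_⟩
  intro n m O hO hOc C hCm hC
  obtain ⟨I, hsubO, hI, hvol⟩ := exists_disjoint_balls hr hB hcube hr0 hfull hO hOc n
  -- Double counting: a ball touched by a cube that is large relative to it charges its volume to
  -- that cube. Otherwise the touching cubes are all small, cover `E i`, and pay through the content
  -- bound.
  let bad : I → C → ℝ≥0∞ := fun i q =>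
    if (dyadicCube q.1 ∩ B i).Nonempty ∧ r i ≤ √d * (2 ^ q.1.1)⁻¹ then volume (B i) else 0
  let good : I → C → ℝ≥0∞ := fun i q =>
    if (dyadicCube q.1 ∩ B i).Nonempty ∧ √d * (2 ^ q.1.1)⁻¹ < r i then
      D * dyadicWeight s q.1.1 else 0
  have hball : ∀ i : I, volume (B i) ≤ ∑' q : C, (bad i q + good i q) := by
    intro i
    by_cases h : ∃ q : C, (dyadicCube q.1 ∩ B i).Nonempty ∧ r i ≤ √d * (2 ^ q.1.1)⁻¹
    · obtain ⟨q, hq⟩ := h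
      calc volume (B i) = bad i q := (if_pos hq).symm
        _ ≤ bad i q + good i q := le_self_add
        _ ≤ _ := ENNReal.le_tsum q
    · push Not at h
      let S : Set C := {q | (dyadicCube q.1 ∩ B i).Nonempty ∧ √d * (2 ^ q.1.1)⁻¹ < r i}
      choose x hx using dyadicCube_nonempty (d := d)
      have hcov : E i ⊆ ⋃ q : S, Metric.closedBall (x q.1.1)
          ((√d * (2 ^ q.1.1.1)⁻¹).toNNReal : ℝ≥0) := by
        intro y hy
        obtain ⟨q, hq, hyq⟩ := Set.mem_iUnion₂.1
          (hC ⟨Set.mem_iUnion₂.2 ⟨i, (hsubO i i.2).1, hy⟩, (hsubO i i.2).2 (hEB i hy)⟩)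
        have hne : (dyadicCube q ∩ B i).Nonempty := ⟨y, hyq, hEB i hy⟩
        refine Set.mem_iUnion.2 ⟨⟨⟨q, hq⟩, hne, h ⟨q, hq⟩ hne⟩, ?_⟩
        rw [Metric.mem_closedBall, Real.coe_toNNReal _ (by positivity)]
        exact dist_le_of_mem_dyadicCube hyq (hx q)
      calc volume (B i) ≤ hausdorffContent s (E i) := hcontent i
        _ ≤ ∑' q : S, (2 * (((√d * (2 ^ q.1.1.1)⁻¹).toNNReal : ℝ≥0) : ℝ≥0∞)) ^ s :=
            hausdorffContent_le_tsum hs0 _ _ hcov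
        _ = ∑' q : S, good i q.1 := by
            refine tsum_congr fun q => ?_
            rw [show good i q.1 = _ from if_pos q.2, ← ofReal_two_pow_inv_rpow, hD,
              ← ENNReal.mul_rpow_of_nonneg _ _ hs0.le, mul_assoc,
              ← ENNReal.ofReal_mul (by positivity)]
            rfl
        _ ≤ ∑' q : C, good i q := ENNReal.tsum_comp_le_tsum_of_injective
            Subtype.val_injective (good i)
        _ ≤ _ := ENNReal.tsum_le_tsum fun q => le_add_self
  have hcol : ∀ q : C, ∑' i, (bad i q + good i q) ≤
      (κ + D) * dyadicWeight (s - t) m * dyadicWeight t q.1.1 := by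
    intro q
    have hw : dyadicWeight s q.1.1 ≤ dyadicWeight (s - t) m * dyadicWeight t q.1.1 := by
      rw [← sub_add_cancel s t, dyadicWeight_add, sub_add_cancel]
      gcongr
      exact dyadicWeight_anti (by linarith) (hCm q.1 q.2)
    have hwd : dyadicWeight d q.1.1 ≤ dyadicWeight s q.1.1 :=
      ENNReal.rpow_le_rpow_of_exponent_ge (by simp) (by gcongr)
    calc ∑' i, (bad i q + good i q) = ∑' i, bad i q + ∑' i, good i q := ENNReal.tsum_add
      _ ≤ κ * dyadicWeight d q.1.1 + D * dyadicWeight s q.1.1 :=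
        add_le_add (tsum_volume_touching_le hr hB hI q.1) (tsum_weight_touching_le hB hI q.1 _)
      _ ≤ κ * dyadicWeight s q.1.1 + D * dyadicWeight s q.1.1 := by gcongr
      _ = (κ + D) * dyadicWeight s q.1.1 := by rw [add_mul]
      _ ≤ (κ + D) * (dyadicWeight (s - t) m * dyadicWeight t q.1.1) := by gcongr
      _ = _ := by rw [mul_assoc]
  calc volume O ≤ 10 ^ d * ∑' i : I, volume (B i) := hvol
    _ ≤ 10 ^ d * ∑' i : I, ∑' q : C, (bad i q + good i q) := by
        gcongr with i; exact hball i
    _ = 10 ^ d * ∑' q : C, ∑' i : I, (bad i q + good i q) := by rw [ENNReal.tsum_comm]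
    _ ≤ 10 ^ d * ∑' q : C, (κ + D) * dyadicWeight (s - t) m * dyadicWeight t q.1.1 := by
        gcongr with q; exact hcol q
    _ = _ := by rw [ENNReal.tsum_mul_left, netCost]; ring

/-- The tail unions of the `E i` are as expensive to cover as the whole of any dyadic cube. -/
theorem dyadicWeight_le_netCost_of_iUnion_inter_subset
    (hr : ∀ i, 0 < r i)
    (hB : ∀ i, B i = Metric.ball (c i) (r i) ∨ B i = Metric.closedBall (c i) (r i))
    (hcube : ∀ i, B i ⊆ unitCube d) (hr0 : Tendsto r atTop (𝓝 0))
    (hfull : volume (limsup B atTop) = 1) {s : ℝ} (hs0 : 0 < s) (hsd : s < d)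
    (hEB : ∀ i, E i ⊆ B i) (hcontent : ∀ i, volume (B i) ≤ hausdorffContent s (E i))
    {t : ℝ} (ht : 0 < t) (hts : t < s) (n : ℕ) {Q : ℕ × (Fin d → ℤ)}
    (hQ : dyadicCube Q ⊆ unitCube d) {C : Set (ℕ × (Fin d → ℤ))}
    (hC : (⋃ i ≥ n, E i) ∩ dyadicCube Q ⊆ ⋃ q ∈ C, dyadicCube q) :
    dyadicWeight t Q.1 ≤ netCost t C := by
  by_contra! hlt
  have hCtop : netCost t C ≠ ∞ := hlt.ne_top
  have hdeep : ∀ q ∈ C, Q.1 + 1 ≤ q.1 := by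
    intro q hq
    by_contra! hle
    exact ((dyadicWeight_anti ht.le (Nat.lt_succ_iff.1 hle)).trans
      (dyadicWeight_le_netCost hq)).not_gt hlt
  obtain ⟨K, hK, hKO⟩ := exists_volume_le_mul_netCost hr hB hcube hr0 hfull hs0 hsd hEB hcontent hts
  have hdt : ∀ m, dyadicWeight d m = dyadicWeight (d - t) m * dyadicWeight t m := fun m => by
    rw [← dyadicWeight_add, sub_add_cancel]
  have hmain : ∀ m, dyadicWeight d Q.1 ≤ K * dyadicWeight (s - t) m * netCost t C +
      dyadicWeight (d - t) (Q.1 + 1) * netCost t C := by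
    intro m
    let box : ℕ × (Fin d → ℤ) → Set (EuclideanSpace ℝ (Fin d)) := fun q =>
      {x | ∀ j, x j ∈ Set.Icc ((q.2 j : ℝ) / 2 ^ q.1) (((q.2 j : ℝ) + 1) / 2 ^ q.1)}
    let U : Set (EuclideanSpace ℝ (Fin d)) :=
      {x | ∀ j, x j ∈ Set.Ioo ((Q.2 j : ℝ) / 2 ^ Q.1) (((Q.2 j : ℝ) + 1) / 2 ^ Q.1)}
    -- The coarse cubes are finitely many since the cost is finite. Removing their closures leaves
    -- an open set that only cubes of level at least `m` can serve.
    let S : Set (ℕ × (Fin d → ℤ)) := {q | q ∈ C ∧ q.1 < m}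
    have hfin : S.Finite := by
      refine ((ENNReal.finite_const_le_of_tsum_ne_top (a := fun q : C => dyadicWeight t q.1.1)
        hCtop (dyadicWeight_pos (s := t) m).ne').image Subtype.val).subset ?_
      rintro q ⟨hq, hqm⟩
      exact ⟨⟨q, hq⟩, dyadicWeight_anti ht.le hqm.le, rfl⟩
    let O : Set (EuclideanSpace ℝ (Fin d)) := U \ ⋃ q ∈ S, box q
    have hUO : U ⊆ O ∪ ⋃ q ∈ S, box q := fun x hx => by
      by_cases h : x ∈ ⋃ q ∈ S, box q
      · exact Or.inr h
      · exact Or.inl ⟨hx, h⟩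
    have hOQ : O ⊆ dyadicCube Q := Set.sdiff_subset.trans (Ioo_subset_dyadicCube Q)
    have hOopen : IsOpen O := (isOpen_setOf_forall_mem_Ioo _ _).sdiff
      (hfin.isClosed_biUnion fun q _ => isClosed_setOf_forall_mem_Icc _ _)
    have hOvol : volume O ≤ K * dyadicWeight (s - t) m * netCost t C := by
      refine (hKO n m O hOopen (hOQ.trans hQ) {q ∈ C | m ≤ q.1} (fun q hq => hq.2) ?_).trans ?_
      · rintro x ⟨hxE, hxO⟩
        obtain ⟨q, hq, hxq⟩ := Set.mem_iUnion₂.1 (hC ⟨hxE, hOQ hxO⟩)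
        refine Set.mem_iUnion₂.2 ⟨q, ⟨hq, ?_⟩, hxq⟩
        by_contra! hqm
        exact hxO.2 (Set.mem_iUnion₂.2 ⟨q, ⟨hq, hqm⟩, dyadicCube_subset_Icc q hxq⟩)
      · gcongr
        exact netCost_mono fun q hq => hq.1
    have hSvol : volume (⋃ q ∈ S, box q) ≤ dyadicWeight (d - t) (Q.1 + 1) * netCost t C := by
      calc volume (⋃ q ∈ S, box q) ≤ ∑' q : S, volume (box q.1) :=
            measure_biUnion_le _ hfin.countable _
        _ ≤ ∑' q : S, dyadicWeight (d - t) (Q.1 + 1) * dyadicWeight t q.1.1 := by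
            refine ENNReal.tsum_le_tsum fun q => ?_
            rw [show volume (box q.1) = _ from volume_Icc_dyadic q.1, hdt]
            gcongr
            exact dyadicWeight_anti (by linarith) (hdeep q.1 q.2.1)
        _ = dyadicWeight (d - t) (Q.1 + 1) * netCost t S := ENNReal.tsum_mul_left
        _ ≤ _ := by gcongr; exact netCost_mono fun q hq => hq.1
    calc dyadicWeight d Q.1 = volume U := (volume_Ioo_dyadic Q).symm
      _ ≤ volume O + volume (⋃ q ∈ S, box q) := (measure_mono hUO).trans (measure_union_le _ _)
      _ ≤ _ := add_le_add hOvol hSvol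
  have hlim : Tendsto (fun m => K * dyadicWeight (s - t) m * netCost t C +
      dyadicWeight (d - t) (Q.1 + 1) * netCost t C) atTop
      (𝓝 (K * 0 * netCost t C + dyadicWeight (d - t) (Q.1 + 1) * netCost t C)) := by
    refine Tendsto.add_const _ (ENNReal.Tendsto.mul_const ?_ (Or.inr hCtop))
    exact ENNReal.Tendsto.const_mul (tendsto_dyadicWeight (by linarith)) (Or.inr hK)
  -- As `m → ∞` the fine cubes drop out. Since the coarse ones are at least one level deeper than
  -- `Q`, a strict factor 2^(-(d-t)) gives the contradiction.
  have hle := ge_of_tendsto' hlim hmain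
  rw [mul_zero, zero_mul, zero_add] at hle
  have hstrict : dyadicWeight (d - t) (Q.1 + 1) < dyadicWeight (d - t) Q.1 := by
    rw [dyadicWeight_eq_pow, dyadicWeight_eq_pow, pow_succ]
    conv_rhs => rw [← mul_one ((2⁻¹ ^ (d - t)) ^ Q.1 : ℝ≥0∞)]
    have h1 := dyadicWeight_pos (s := (d : ℝ) - t) Q.1
    have h2 := dyadicWeight_ne_top (s := (d : ℝ) - t) Q.1
    rw [dyadicWeight_eq_pow] at h1 h2
    exact (ENNReal.mul_lt_mul_iff_right h1.ne' h2).2 (two_inv_rpow_lt_one (by linarith))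
  refine hle.not_gt ?_
  rw [hdt]
  exact ENNReal.mul_lt_mul hstrict hlt

end Saturation

/-! ### From dyadic covering costs to Hausdorff measure -/

section HausdorffLower

variable {d : ℕ}

/-- The dyadic cube of level `m` obtained from the one around `x` by a shift by `e - 1`. -/
noncomputable def dyadicNeighbor (m : ℕ) (x : EuclideanSpace ℝ (Fin d)) (e : Fin d → Fin 3) :
    ℕ × (Fin d → ℤ) :=
  (m, fun j => ⌊(2 : ℝ) ^ m * x j⌋ + (e j : ℤ) - 1)

theorem ball_subset_iUnion_dyadicNeighbor (m : ℕ) (x : EuclideanSpace ℝ (Fin d)) :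
    Metric.ball x ((2 ^ m)⁻¹) ⊆ ⋃ e, dyadicCube (dyadicNeighbor m x e) := by
  intro y hy
  have hclose : ∀ j, |(2 : ℝ) ^ m * y j - 2 ^ m * x j| < 1 := by
    intro j
    have h1 : ‖(y - x) j‖ < ((2 : ℝ) ^ m)⁻¹ :=
      (PiLp.norm_apply_le (y - x) j).trans_lt (by rwa [← dist_eq_norm])
    have h2 : (0 : ℝ) < 2 ^ m := by positivity
    rw [← mul_sub, abs_mul, abs_of_pos h2]
    calc (2 : ℝ) ^ m * |y j - x j| < 2 ^ m * (2 ^ m)⁻¹ := by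
          gcongr
          simpa using h1
      _ = 1 := mul_inv_cancel₀ h2.ne'
  have hfloor : ∀ j, -1 ≤ ⌊(2 : ℝ) ^ m * y j⌋ - ⌊(2 : ℝ) ^ m * x j⌋ ∧
      ⌊(2 : ℝ) ^ m * y j⌋ - ⌊(2 : ℝ) ^ m * x j⌋ ≤ 1 := by
    intro j
    obtain ⟨h1, h2⟩ := abs_lt.1 (hclose j)
    have h3 := Int.floor_le ((2 : ℝ) ^ m * y j)
    have h4 := Int.lt_floor_add_one ((2 : ℝ) ^ m * y j)
    have h5 := Int.floor_le ((2 : ℝ) ^ m * x j)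
    have h6 := Int.lt_floor_add_one ((2 : ℝ) ^ m * x j)
    have h7 : (⌊(2 : ℝ) ^ m * x j⌋ : ℝ) < ⌊(2 : ℝ) ^ m * y j⌋ + 2 := by linarith
    have h8 : (⌊(2 : ℝ) ^ m * y j⌋ : ℝ) < ⌊(2 : ℝ) ^ m * x j⌋ + 2 := by linarith
    have h9 : ⌊(2 : ℝ) ^ m * x j⌋ < ⌊(2 : ℝ) ^ m * y j⌋ + 2 := by exact_mod_cast h7
    have h10 : ⌊(2 : ℝ) ^ m * y j⌋ < ⌊(2 : ℝ) ^ m * x j⌋ + 2 := by exact_mod_cast h8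
    constructor <;> linarith
  refine Set.mem_iUnion.2 ⟨fun j =>
    ⟨(⌊(2 : ℝ) ^ m * y j⌋ - ⌊(2 : ℝ) ^ m * x j⌋ + 1).toNat, by have := hfloor j; omega⟩,
    fun j => ?_⟩
  have := hfloor j
  simp only [dyadicNeighbor]
  omega

theorem netCost_range_le {t : ℝ} {ι : Type*} (f : ι → ℕ × (Fin d → ℤ)) :
    netCost t (Set.range f) ≤ ∑' i, dyadicWeight t (f i).1 := by
  calc netCost t (Set.range f)
      = ∑' q : Set.range f, dyadicWeight t (f (Set.rangeSplitting f q)).1 := by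
        simp only [Set.apply_rangeSplitting]; rfl
    _ ≤ _ := ENNReal.tsum_comp_le_tsum_of_injective (Set.rangeSplitting_injective f)
        fun i => dyadicWeight t (f i).1

/-- For `δ > 0` take the last level with `δ < 2^(-m)`; the next side is at most `δ`, which costs the
factor 2^t. For `δ = 0` there is no last level, and the slack `η` is needed. -/
theorem exists_dyadicWeight_le {t : ℝ} (ht : 0 < t) {δ : ℝ≥0∞} (hδ : δ < 1) {η : ℝ≥0∞}
    (hη : 0 < η) :
    ∃ m : ℕ, δ < ENNReal.ofReal ((2 ^ m)⁻¹) ∧ dyadicWeight t m ≤ 2 ^ t * δ ^ t + η := by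
  have hpow : ∀ m : ℕ, ENNReal.ofReal ((2 ^ m)⁻¹) = 2⁻¹ ^ m := fun m => by
    rw [← ENNReal.rpow_one (ENNReal.ofReal _), ofReal_two_pow_inv_rpow, dyadicWeight_eq_pow,
      ENNReal.rpow_one]
  rcases eq_or_ne δ 0 with rfl | hδ0
  · obtain ⟨m, hm⟩ := ((tendsto_dyadicWeight ht).eventually_lt_const hη).exists
    exact ⟨m, by positivity, hm.le.trans le_add_self⟩
  · have hex : ∃ m : ℕ, ENNReal.ofReal ((2 ^ m)⁻¹) ≤ δ := by
      have hlim : Tendsto (fun m : ℕ => (2⁻¹ : ℝ≥0∞) ^ m) atTop (𝓝 0) :=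
        ENNReal.tendsto_pow_atTop_nhds_zero_of_lt_one (by simp)
      obtain ⟨m, hm⟩ := (hlim.eventually_lt_const (pos_iff_ne_zero.2 hδ0)).exists
      exact ⟨m, by rw [hpow]; exact hm.le⟩
    classical
    obtain ⟨m, hm⟩ : ∃ m, Nat.find hex = m + 1 := by
      refine Nat.exists_eq_succ_of_ne_zero fun h0 => ?_
      have := Nat.find_spec hex
      rw [h0] at this
      simp only [pow_zero, inv_one, ENNReal.ofReal_one] at this
      exact this.not_gt hδ
    refine ⟨m, not_le.1 (Nat.find_min hex (by omega)), le_trans ?_ le_self_add⟩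
    have hspec := Nat.find_spec hex
    rw [hm] at hspec
    calc dyadicWeight t m = 2 ^ t * dyadicWeight t (m + 1) := by
          rw [dyadicWeight_eq_pow, dyadicWeight_eq_pow, pow_succ', ← mul_assoc,
            ← ENNReal.mul_rpow_of_nonneg _ _ ht.le, ENNReal.mul_inv_cancel (by simp) (by simp),
            ENNReal.one_rpow, one_mul]
      _ ≤ 2 ^ t * δ ^ t := by
          rw [← ofReal_two_pow_inv_rpow]
          gcongr

/-- A set containing a decreasing intersection of compact sets that are uniformly expensive to cover
by dyadic cubes has positive Hausdorff measure. -/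
theorem hausdorffMeasure_ne_zero_of_netCost {t : ℝ} (ht : 0 < t)
    {A : Set (EuclideanSpace ℝ (Fin d))} {K : ℕ → Set (EuclideanSpace ℝ (Fin d))}
    (hK : ∀ n, IsCompact (K n)) (hanti : Antitone K) (hKA : ⋂ n, K n ⊆ A) {b : ℝ≥0∞} (hb : b ≠ 0)
    (hcost : ∀ n, ∀ C : Set (ℕ × (Fin d → ℤ)), K n ⊆ ⋃ q ∈ C, dyadicCube q → b ≤ netCost t C) :
    Measure.hausdorffMeasure t A ≠ 0 := by
  intro h0
  set M : ℝ≥0∞ := 3 ^ d * 2 ^ t with hM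
  have hMtop : M ≠ ∞ := ENNReal.mul_ne_top (by simp)
    (ENNReal.rpow_ne_top_of_nonneg ht.le (by simp))
  rw [Measure.hausdorffMeasure_apply, ENNReal.iSup_eq_zero] at h0
  have h1 := ENNReal.iSup_eq_zero.1 (h0 2⁻¹) (by simp)
  have hη : 0 < b / 2 / M := ENNReal.div_pos (ENNReal.div_pos hb (by simp)).ne' hMtop
  have h2 := h1.trans_lt hη
  simp only [iInf_lt_iff] at h2
  obtain ⟨T, hcov, hdiam, hsum⟩ := h2
  obtain ⟨η, hηpos, hηsum⟩ := ENNReal.exists_pos_sum_of_countable' (ε := b / 2 / 3 ^ d)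
    (ENNReal.div_pos (ENNReal.div_pos hb (by simp)).ne' (by simp)).ne' {n // (T n).Nonempty}
  have hlevel : ∀ n : {n // (T n).Nonempty}, ∃ m : ℕ,
      Metric.ediam (T n) < ENNReal.ofReal ((2 ^ m)⁻¹) ∧
      dyadicWeight t m ≤ 2 ^ t * Metric.ediam (T n) ^ t + η n := fun n =>
    exists_dyadicWeight_le ht ((hdiam n).trans_lt (by simp)) (hηpos n)
  choose m hm1 hm2 using hlevel
  choose x hx using fun n : {n // (T n).Nonempty} => n.2
  let U : Set (EuclideanSpace ℝ (Fin d)) := ⋃ n, Metric.ball (x n) ((2 ^ m n)⁻¹)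
  have hAU : A ⊆ U := by
    intro y hy
    obtain ⟨n, hn⟩ := Set.mem_iUnion.1 (hcov hy)
    refine Set.mem_iUnion.2 ⟨⟨n, ⟨y, hn⟩⟩, ?_⟩
    rw [Metric.mem_ball, ← ENNReal.ofReal_lt_ofReal_iff (by positivity), ← edist_dist]
    exact (Metric.edist_le_ediam_of_mem hn (hx ⟨n, ⟨y, hn⟩⟩)).trans_lt (hm1 ⟨n, ⟨y, hn⟩⟩)
  have hU : IsOpen U := isOpen_iUnion fun n => Metric.isOpen_ball
  -- The cover was enlarged to an open one, so by compactness it already covers some `K n`, to which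
  -- the cost bound applies.
  obtain ⟨n, hn⟩ := exists_subset_nhds_of_isCompact (V := K)
    (directed_of_isDirected_le fun _ _ h => hanti h) hK
    fun y hy => hU.mem_nhds (hAU (hKA hy))
  let f : {n // (T n).Nonempty} × (Fin d → Fin 3) → ℕ × (Fin d → ℤ) := fun p =>
    dyadicNeighbor (m p.1) (x p.1) p.2
  have hUf : U ⊆ ⋃ q ∈ Set.range f, dyadicCube q := by
    refine Set.iUnion_subset fun n => (ball_subset_iUnion_dyadicNeighbor _ _).trans ?_
    refine Set.iUnion_subset fun e => ?_
    exact Set.subset_biUnion_of_mem (u := fun q => dyadicCube q) ⟨(n, e), rfl⟩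
  refine (hcost n _ (hn.trans hUf)).not_gt ?_
  calc netCost t (Set.range f) ≤ ∑' p, dyadicWeight t (f p).1 := netCost_range_le f
    _ = 3 ^ d * ∑' n, dyadicWeight t (m n) := by
        rw [ENNReal.summable.tsum_prod' fun _ => ENNReal.summable, ← ENNReal.tsum_mul_left]
        refine tsum_congr fun n => ?_
        simp [f, dyadicNeighbor, tsum_fintype]
    _ ≤ 3 ^ d * ∑' n : {n // (T n).Nonempty}, (2 ^ t * Metric.ediam (T n) ^ t + η n) := by
        gcongr with n; exact hm2 n
    _ = M * ∑' n : {n // (T n).Nonempty}, Metric.ediam (T n) ^ t + 3 ^ d * ∑' n, η n := by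
        rw [ENNReal.tsum_add, ENNReal.tsum_mul_left, mul_add, hM, mul_assoc]
    _ ≤ M * (∑' n, ⨆ (_ : (T n).Nonempty), Metric.ediam (T n) ^ t) + 3 ^ d * ∑' n, η n := by
        gcongr
        refine le_trans (ENNReal.tsum_le_tsum fun n => ?_)
          (ENNReal.tsum_comp_le_tsum_of_injective Subtype.val_injective
            fun n => ⨆ (_ : (T n).Nonempty), Metric.ediam (T n) ^ t)
        exact le_iSup_of_le n.2 le_rfl
    _ < b / 2 + b / 2 := ENNReal.add_lt_add (ENNReal.mul_lt_of_lt_div' hsum)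
        (ENNReal.mul_lt_of_lt_div' hηsum)
    _ = b := ENNReal.add_halves b

end HausdorffLower

/-! ### Packing measures and Baire category -/

section Packing

variable {d : ℕ}

theorem ediam_closedBall_eq (hd : d ≠ 0) (x : EuclideanSpace ℝ (Fin d)) {ρ : ℝ} (hρ : 0 ≤ ρ) :
    Metric.ediam (Metric.closedBall x ρ) = 2 * ENNReal.ofReal ρ := by
  have : Nonempty (Fin d) := ⟨⟨0, Nat.pos_of_ne_zero hd⟩⟩
  rw [← ENNReal.ofReal_toReal (Metric.isBounded_closedBall (x := x) (r := ρ)).ediam_ne_top]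
  change ENNReal.ofReal (Metric.diam _) = _
  rw [Metric.diam_closedBall_eq x hρ, ENNReal.ofReal_mul (by norm_num)]
  simp

/-- For radii at most 1 and u ≥ d, (diam)^u is at most a multiple of the volume, and disjoint balls
centred in `A` share the finite volume of its 1-thickening. -/
theorem packingPremeasure_ne_top_of_isBounded (hd : d ≠ 0) {u : ℝ} (hu : d ≤ u)
    {A : Set (EuclideanSpace ℝ (Fin d))} (hA : Bornology.IsBounded A) :
    packingPremeasure u A ≠ ∞ := by
  set β : ℝ≥0∞ := volume (Metric.ball (0 : EuclideanSpace ℝ (Fin d)) 1) with hβ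
  have hβ0 : β ≠ 0 := (Metric.measure_ball_pos _ _ one_pos).ne'
  have hβtop : β ≠ ∞ := measure_ball_lt_top.ne
  have hu0 : 0 ≤ u := (Nat.cast_nonneg d).trans hu
  set V : ℝ≥0∞ := volume (Metric.cthickening 1 A) with hV
  have hVtop : V ≠ ∞ := hA.cthickening.measure_lt_top.ne
  refine ne_top_of_le_ne_top (b := 2 ^ u * (V / β)) (ENNReal.mul_ne_top
    (ENNReal.rpow_ne_top_of_nonneg hu0 (by simp)) (ENNReal.div_ne_top hVtop hβ0)) ?_
  refine iInf₂_le_of_le 1 one_pos (iSup₂_le fun P hP => ?_)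
  have hterm : ∀ p : P, Metric.ediam (Metric.closedBall p.1.1 p.1.2) ^ u ≤
      2 ^ u * (volume (Metric.closedBall p.1.1 p.1.2) / β) := by
    intro p
    have hp0 := hP.radius_pos p p.2
    rw [ediam_closedBall_eq hd _ hp0.le, ENNReal.mul_rpow_of_nonneg _ _ hu0,
      Measure.addHaar_closedBall _ _ hp0.le, finrank_euclideanSpace_fin, ← hβ,
      ENNReal.mul_div_cancel_right hβ0 hβtop, ENNReal.ofReal_pow hp0.le, ← ENNReal.rpow_natCast]
    gcongr 2 ^ u * ?_
    exact ENNReal.rpow_le_rpow_of_exponent_ge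
      (by simpa using hP.radius_le p p.2) hu
  calc ∑' p : P, Metric.ediam (Metric.closedBall p.1.1 p.1.2) ^ u
      ≤ ∑' p : P, 2 ^ u * (volume (Metric.closedBall p.1.1 p.1.2) / β) :=
        ENNReal.tsum_le_tsum hterm
    _ = 2 ^ u * ((∑' p : P, volume (Metric.closedBall p.1.1 p.1.2)) / β) := by
        simp only [ENNReal.tsum_mul_left, div_eq_mul_inv, ENNReal.tsum_mul_right]
    _ ≤ 2 ^ u * (V / β) := by
        gcongr
        refine (tsum_meas_le_meas_iUnion_of_disjoint volume
          (fun p : P => measurableSet_closedBall) fun p p' h => ?_).trans (measure_mono ?_)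
        · exact hP.disjoint p.2 p'.2 fun h' => h (Subtype.ext h')
        · refine Set.iUnion_subset fun p => ?_
          exact (Metric.closedBall_subset_closedBall (hP.radius_le p p.2)).trans
            (Metric.closedBall_subset_cthickening (hP.center_mem p p.2) 1)

theorem packingPremeasure_empty (u : ℝ) :
    packingPremeasure u (∅ : Set (EuclideanSpace ℝ (Fin d))) = 0 := by
  refine le_antisymm (iInf₂_le_of_le 1 one_pos (iSup₂_le fun P hP => ?_)) zero_le
  have : IsEmpty P := ⟨fun p => hP.center_mem p p.2⟩
  simp

theorem packingMeasure_le_packingPremeasure (u : ℝ) (A : Set (EuclideanSpace ℝ (Fin d))) :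
    packingMeasure u A ≤ packingPremeasure u A := by
  refine iInf₂_le_of_le (fun n => if n = 0 then A else ∅)
    (fun x hx => Set.mem_iUnion.2 ⟨0, by simpa using hx⟩) ?_
  rw [tsum_eq_single 0 fun n hn => by simp [hn, packingPremeasure_empty]]
  simp

theorem dimP_le_of_isBounded (hd : d ≠ 0) {A : Set (EuclideanSpace ℝ (Fin d))}
    (hA : Bornology.IsBounded A) : dimP A ≤ d := by
  refine iSup₂_le fun u hu => ?_
  by_contra! hlt
  have h : (d : ℝ) ≤ u := by
    have : ((d : ℝ≥0) : ℝ≥0∞) < u := by simpa using hlt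
    exact_mod_cast (ENNReal.coe_lt_coe.1 this).le
  exact packingPremeasure_ne_top_of_isBounded hd h hA
    (top_le_iff.1 (hu.symm.le.trans (packingMeasure_le_packingPremeasure _ _)))

/-- A set which is dense in some nonempty open set has infinite packing premeasure in every
dimension less than `d`. -/
theorem packingPremeasure_eq_top_of_subset_closure (hd : d ≠ 0) {u : ℝ} (hu : u < d)
    {S U : Set (EuclideanSpace ℝ (Fin d))} (hU : IsOpen U) (hne : U.Nonempty)
    (hUS : U ⊆ closure S) : packingPremeasure u S = ∞ := by
  refine iInf₂_eq_top.2 fun δ hδ => ?_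
  by_contra hM
  set M : ℝ≥0∞ := ⨆ (P : Set (EuclideanSpace ℝ (Fin d) × ℝ)) (_ : IsPacking δ S P),
    ∑' p : P, Metric.ediam (Metric.closedBall p.1.1 p.1.2) ^ u with hMdef
  set κ : ℝ≥0∞ := ENNReal.ofReal (5 ^ d) *
    volume (Metric.ball (0 : EuclideanSpace ℝ (Fin d)) 1) * (2 ^ u)⁻¹ with hκ
  have h2u : (2 : ℝ≥0∞) ^ u ≠ 0 := (ENNReal.rpow_pos (by simp) (by simp)).ne'
  have h2u' : (2 : ℝ≥0∞) ^ u ≠ ∞ := ENNReal.rpow_ne_top_of_ne_zero (by simp) (by simp)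
  have hκtop : κ ≠ ∞ := ENNReal.mul_ne_top
    (ENNReal.mul_ne_top ENNReal.ofReal_ne_top measure_ball_lt_top.ne) (ENNReal.inv_ne_top.2 h2u)
  -- Packing `S` by balls of equal radius 2^(-m) with Vitali, the fivefold balls cover `U`. If the
  -- packing sums were bounded by a finite `M`, letting `m → ∞` would force `U` to be null.
  have hmain : ∀ m : ℕ, ((2 : ℝ) ^ m)⁻¹ ≤ δ → volume U ≤ κ * dyadicWeight (d - u) m * M := by
    intro m hm
    set ρ : ℝ := ((2 : ℝ) ^ m)⁻¹ with hρ
    have hρ0 : 0 < ρ := by positivity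
    obtain ⟨v, hvS, hdisj, hcov⟩ := Vitali.exists_disjoint_subfamily_covering_enlargement_closedBall
      S id (fun _ => ρ) ρ (fun _ _ => le_rfl) 5 (by norm_num)
    have hcount : v.Countable := hdisj.countable_of_nonempty_interior fun x _ =>
      ⟨x, Metric.ball_subset_interior_closedBall (Metric.mem_ball_self hρ0)⟩
    have hpack : IsPacking δ S ((fun x => (x, ρ)) '' v) := by
      refine ⟨?_, ?_, ?_, ?_⟩
      · rintro _ ⟨x, hx, rfl⟩; exact hvS hx
      · rintro _ ⟨x, hx, rfl⟩; exact hρ0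
      · rintro _ ⟨x, hx, rfl⟩; exact hm
      · rintro _ ⟨x, hx, rfl⟩ _ ⟨y, hy, rfl⟩ hxy
        exact hdisj hx hy fun h => hxy (by rw [h])
    have hsum : ∑' _x : v, 2 ^ u * dyadicWeight u m ≤ M := by
      refine le_trans (le_of_eq ?_) (le_iSup₂_of_le _ hpack le_rfl)
      rw [tsum_image (f := fun p : EuclideanSpace ℝ (Fin d) × ℝ =>
        Metric.ediam (Metric.closedBall p.1 p.2) ^ u)
        (fun x _ y _ h => congrArg Prod.fst h)]
      refine tsum_congr fun x => ?_
      rw [ediam_closedBall_eq hd _ hρ0.le, ENNReal.mul_rpow_of_ne_top (by simp) (by simp), hρ,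
        ofReal_two_pow_inv_rpow]
    calc volume U ≤ volume (⋃ x : v, Metric.closedBall x.1 (5 * ρ)) := by
          refine measure_mono fun y hy => ?_
          obtain ⟨x, hx, hyx⟩ := Metric.mem_closure_iff.1 (hUS hy) ρ hρ0
          obtain ⟨b, hb, hxb⟩ := hcov x hx
          exact Set.mem_iUnion.2 ⟨⟨b, hb⟩, hxb (Metric.mem_closedBall.2 hyx.le)⟩
      _ ≤ ∑' x : v, volume (Metric.closedBall x.1 (5 * ρ)) := by
          have := hcount.to_subtype
          exact measure_iUnion_le _
      _ = ∑' _x : v, κ * dyadicWeight (d - u) m * (2 ^ u * dyadicWeight u m) := by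
          refine tsum_congr fun x => ?_
          rw [Measure.addHaar_closedBall _ _ (by positivity), finrank_euclideanSpace_fin, mul_pow,
            ENNReal.ofReal_mul (by positivity), ENNReal.ofReal_pow hρ0.le, hρ,
            ofReal_two_pow_inv_pow, hκ]
          conv_lhs => rw [← sub_add_cancel (d : ℝ) u, dyadicWeight_add]
          calc _ = ENNReal.ofReal (5 ^ d) *
                  volume (Metric.ball (0 : EuclideanSpace ℝ (Fin d)) 1) * 1 *
                  (dyadicWeight (d - u) m * dyadicWeight u m) := by ring
            _ = _ := by rw [← ENNReal.inv_mul_cancel h2u h2u']; ring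
      _ = κ * dyadicWeight (d - u) m * ∑' _x : v, 2 ^ u * dyadicWeight u m :=
          ENNReal.tsum_mul_left
      _ ≤ _ := by gcongr
  have hlim : Tendsto (fun m => κ * dyadicWeight (d - u) m * M) atTop (𝓝 (κ * 0 * M)) :=
    ENNReal.Tendsto.mul_const (ENNReal.Tendsto.const_mul (tendsto_dyadicWeight (by linarith))
      (Or.inr hκtop)) (Or.inr hM)
  have hsmall : ∀ᶠ m : ℕ in atTop, ((2 : ℝ) ^ m)⁻¹ ≤ δ := by
    have : Tendsto (fun m : ℕ => ((2 : ℝ) ^ m)⁻¹) atTop (𝓝 0) := by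
      simp only [← inv_pow]
      exact tendsto_pow_atTop_nhds_zero_of_lt_one (by norm_num) (by norm_num)
    exact (this.eventually_lt_const hδ).mono fun _ h => h.le
  have hle := ge_of_tendsto hlim (hsmall.mono hmain)
  rw [mul_zero, zero_mul] at hle
  exact (hU.measure_pos volume hne).not_ge hle

/-- A set which contains a nonempty open piece of a countable intersection of open dense sets has
infinite packing measure in every dimension less than `d`. -/
theorem packingMeasure_eq_top_of_iInter_inter_subset (hd : d ≠ 0) {u : ℝ} (hu : u < d)
    {O : ℕ → Set (EuclideanSpace ℝ (Fin d))} (hO : ∀ n, IsOpen (O n)) (hdense : ∀ n, Dense (O n))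
    {W A : Set (EuclideanSpace ℝ (Fin d))} (hW : IsOpen W) (hWne : W.Nonempty)
    (hA : (⋂ n, O n) ∩ W ⊆ A) : packingMeasure u A = ∞ := by
  refine iInf₂_eq_top.2 fun S hS => ?_
  by_cases h : ∃ n, (interior (closure (S n))).Nonempty
  · obtain ⟨n, hn⟩ := h
    exact ENNReal.tsum_eq_top_of_eq_top ⟨n, packingPremeasure_eq_top_of_subset_closure hd hu
      isOpen_interior hn interior_subset⟩
  · push Not at h
    -- If every `S n` were nowhere dense, the complements of their closures would be open and dense,
    -- and Baire would give a point of `A` outside all `S n`.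
    exfalso
    have hd' : Dense (⋂ n, O n ∩ (closure (S n))ᶜ) := by
      refine dense_iInter_of_isOpen (fun n => (hO n).inter isClosed_closure.isOpen_compl)
        fun n => (hdense n).inter_of_isOpen_left (interior_eq_empty_iff_dense_compl.1 (h n)) (hO n)
    obtain ⟨x, hxW, hx⟩ := hd'.inter_open_nonempty W hW hWne
    rw [Set.mem_iInter] at hx
    obtain ⟨n, hn⟩ := Set.mem_iUnion.1 (hS (hA ⟨Set.mem_iInter.2 fun n => (hx n).1, hxW⟩))
    exact (hx n).2 (subset_closure hn)

end Packing

/-! ### The main theorem -/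

theorem hausdorffContent_empty {d : ℕ} {s : ℝ} (hs : 0 < s) :
    hausdorffContent s (∅ : Set (EuclideanSpace ℝ (Fin d))) = 0 := by
  refine le_antisymm ((hausdorffContent_le_tsum hs (ι := Empty) (fun e => e.elim)
    (fun e => e.elim) (Set.empty_subset _)).trans ?_) zero_le
  simp

theorem limsup_eq_iInter_iUnion_ge {d : ℕ} (E : ℕ → Set (EuclideanSpace ℝ (Fin d))) :
    limsup E atTop = ⋂ n, ⋃ i ≥ n, E i := by
  simp only [limsup_eq_iInf_iSup_of_nat, Set.iInf_eq_iInter, Set.iSup_eq_iUnion]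

theorem corollary3p4 (d : ℕ)
    (B : ℕ → Set (EuclideanSpace ℝ (Fin d))) (E : ℕ → Set (EuclideanSpace ℝ (Fin d)))
    (c : ℕ → EuclideanSpace ℝ (Fin d)) (r : ℕ → ℝ)
    (hr : ∀ i, 0 < r i)
    (hB : ∀ i, B i = Metric.ball (c i) (r i) ∨ B i = Metric.closedBall (c i) (r i))
    (hcube : ∀ i, B i ⊆ unitCube d)
    (hr0 : Tendsto r atTop (𝓝 0))
    (hfull : volume (limsup B atTop) = 1)
    (s : ℝ) (hs0 : 0 < s) (hsd : s < d)
    (hE : ∀ i, IsOpen (E i)) (hEB : ∀ i, E i ⊆ B i)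
    (hcontent : ∀ i, volume (B i) ≤ hausdorffContent s (E i)) :
    ENNReal.ofReal s ≤ dimH (limsup E atTop) ∧ dimP (limsup E atTop) = d := by
  have hd : d ≠ 0 := by
    rintro rfl
    exact absurd (hs0.trans hsd) (by simp)
  have hG : ∀ n, IsOpen (⋃ i ≥ n, E i) := fun n => isOpen_biUnion fun i _ => hE i
  have hunit : dyadicCube ((0, 0) : ℕ × (Fin d → ℤ)) ⊆ unitCube d := fun x hx j => by
    simpa using dyadicCube_subset_Icc _ hx j
  constructor
  · refine ENNReal.le_of_forall_nnreal_lt fun t hts => ?_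
    rcases eq_or_ne t 0 with rfl | ht0
    · simp
    have hts' : (t : ℝ) < s := by
      rw [← ENNReal.ofReal_coe_nnreal] at hts
      exact (ENNReal.ofReal_lt_ofReal_iff hs0).1 hts
    have ht : (0 : ℝ) < t := by exact_mod_cast pos_iff_ne_zero.2 ht0
    -- The starting cube has level 0 and weight 1, so any `b` strictly between 0 and 1 would do.
    obtain ⟨K, hK, hanti, hKG, hcost⟩ := exists_compact_seq_of_saturated (t := t) hG
      isBounded_unitCube
      (fun n J hJ C hC => dyadicWeight_le_netCost_of_iUnion_inter_subset hr hB hcube hr0 hfull hs0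
        hsd hEB hcontent ht hts' n hJ hC) hunit
      (b := 2⁻¹) (by simp [dyadicWeight])
    rw [← limsup_eq_iInter_iUnion_ge] at hKG
    exact le_dimH_of_hausdorffMeasure_ne_zero
      (hausdorffMeasure_ne_zero_of_netCost ht hK hanti hKG (by simp) hcost)
  · have hEne : ∀ i, (E i).Nonempty := by
      intro i
      rw [Set.nonempty_iff_ne_empty]
      intro h
      have hpos : 0 < volume (B i) := (Metric.measure_ball_pos volume (c i) (hr i)).trans_le
        (measure_mono (ball_subset_of_eq_ball_or (hB i)))
      have := hcontent i
      rw [h, hausdorffContent_empty hs0] at this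
      exact hpos.not_ge this
    refine le_antisymm (dimP_le_of_isBounded hd (isBounded_unitCube.subset fun x hx => ?_)) ?_
    · obtain ⟨i, hi⟩ := (mem_limsup_iff_frequently_mem.1 hx).exists
      exact hcube i (hEB i hi)
    refine ENNReal.le_of_forall_nnreal_lt fun u hu => ?_
    have hu' : (u : ℝ) < d := by
      have : (u : ℝ≥0∞) < ((d : ℝ≥0) : ℝ≥0∞) := by simpa using hu
      exact_mod_cast ENNReal.coe_lt_coe.1 this
    refine le_iSup₂_of_le u ?_ le_rfl
    -- Adding the complement of the cube makes the tail unions dense in the whole space;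
    -- intersecting with the open cube `W` removes it again.
    refine packingMeasure_eq_top_of_iInter_inter_subset hd hu'
      (O := fun n => (⋃ i ≥ n, E i) ∪ (unitCube d)ᶜ)
      (fun n => (hG n).union isClosed_unitCube.isOpen_compl) (fun n => ?_)
      (W := {x | ∀ j, x j ∈ Set.Ioo (0 : ℝ) 1}) (isOpen_setOf_forall_mem_Ioo _ _)
      ⟨WithLp.toLp 2 fun _ => 1 / 2, fun j => by norm_num⟩ ?_
    · refine dense_iff_inter_open.2 fun V hV hVne => ?_
      by_cases hVc : V ⊆ unitCube d
      · have hpos := (hV.measure_pos volume hVne).trans_le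
          (volume_le_volume_iUnion_of_limsup hB hcube hr0 hfull hV hVc n)
        obtain ⟨x, hx⟩ := nonempty_of_measure_ne_zero hpos.ne'
        obtain ⟨i, ⟨hni, hiV⟩, -⟩ := Set.mem_iUnion₂.1 hx
        obtain ⟨y, hy⟩ := hEne i
        exact ⟨y, hiV (hEB i hy), Or.inl (Set.mem_iUnion₂.2 ⟨i, hni, hy⟩)⟩
      · obtain ⟨x, hxV, hx⟩ := Set.not_subset.1 hVc
        exact ⟨x, hxV, Or.inr hx⟩
    · rintro x ⟨hx, hxW⟩
      rw [limsup_eq_iInter_iUnion_ge]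
      refine Set.mem_iInter.2 fun n => (Set.mem_iInter.1 hx n).resolve_right fun h => h fun j => ?_
      exact Set.Ioo_subset_Icc_self (hxW j)
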